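/- Let $g>1$. A \emph{Feynman graph} of genus $g$ is a connected trivalent graph $\Gamma$ (multiple edges and loops allowed) of first Betti number $g$, with its vertices labeled $x_1,\dots,x_{2g-2}$ and its edges labeled $q_1,\dots,q_{3g-3}$; one such reference labeling is fixed for each isomorphism class of unlabeled graphs. \textbf{Labeled tropical covers.} Let $E=\mathbb R/L\mathbb Z$ ($L>0$) be a tropical elliptic curve, $p_1,\dots,p_{2g-2}\in E$ pairwise distinct points, and $p_0\in E$ a base point different from all $p_i$. A labeled tropical cover of type $\Gamma$ is a metric graph $C$ (positive edge lengths) with underlying labeled graph $\Gamma$ together with a non-constant continuous map $\pi:C\to E$ that is affine with integer slope on each edge and balanced at each vertex: the weights of the rays mapping to the two sides of the image of the vertex have equal sums, where the weight $w_k$ of $q_k$ is the absolute value of the slope of $\pi$ on $q_k$. Its branch points are the images of the vertices; its degree is $\sum_k w_k\cdot\#(\pi^{-1}(p)\cap q_k)$ for any $p\in E$ that is not a branch point. Isomorphisms are isometries over $E$ that respect all labels. For $\underline a=(a_1,\dots,a_{3g-3})\in\mathbb N_{\ge0}^{3g-3}$, let $N^{\mathrm{trop}}_{\underline a,\Gamma}$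 be the number of isomorphism classes of labeled tropical covers of type $\Gamma$ and degree $\sum_k a_k$, with set of branch points $\{p_1,\dots,p_{2g-2}\}$ and with $\#(\pi^{-1}(p_0)\cap q_k)\cdot w_k=a_k$ for all $k$, each counted with multiplicity $\prod_k w_k$. Let $N^{\mathrm{trop}}_{\underline a,g}$ be the same count over all Feynman graphs $\Gamma$ of genus $g$, and put $q^{2\underline a}=\prod_k q_k^{2a_k}$ and $F_g(q_1,\dots,q_{3g-3})=\sum_{\underline a}N^{\mathrm{trop}}_{\underline a,g}\,q^{2\underline a}$. \textbf{Refined Feynman integrals.} For $q=e^{i\pi\tau}$ with $\operatorname{Im}\tau>0$ let $P(z,q)=\frac1{4\pi^2}\wp(z,q)+\frac1{12}E_2(q^2)$, where $\wp(\cdot,q)$ is the Weierstrass function of the lattice $\mathbb Z+\mathbb Z\tau$ and $E_2(q)=1-24\sum_{d\ge1}\sigma_1(d)q^d$. Let $\Gamma$ be a Feynman graph without loops, and let $q_k=e^{i\pi\tau_k}$ with $\operatorname{Im}\tau_k>0$. For a total order $\Omega$ of the vertices choose real numbers $y_1,\dots,y_{2g-2}$ ordered according to $\Omega$, pairwise different,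 with $|y_i-y_j|<\operatorname{Im}\tau_k$ for all $i,j,k$, let $\gamma_j(t)=iy_j+t$ for $t\in[0,1]$, and put $$I_{\Gamma,\Omega}(q_1,\dots,q_{3g-3})=\int_{z_j\in\gamma_j}\prod_{k=1}^{3g-3}\bigl(-P(z_{k_1}-z_{k_2},q_k)\bigr),\qquad I_\Gamma=\sum_\Omega I_{\Gamma,\Omega},$$ where $x_{k_1},x_{k_2}$ are the end vertices of $q_k$ and the sum is over all $(2g-2)!$ orders. \textbf{Theorem (Tropical mirror symmetry for elliptic curves).} All the counts above are finite, and $N^{\mathrm{trop}}_{\underline a,\Gamma}=0$ for all $\underline a$ if $\Gamma$ has a loop. The integrals $I_{\Gamma,\Omega}$ exist, and for all $q_k$ with $0<|q_k|<1$ and all admissible choices of the $y_j$, with absolutely convergent series, $$F_g(q_1,\dots,q_{3g-3})=\sum_{\underline a}N^{\mathrm{trop}}_{\underline a,g}\,q^{2\underline a}=\sum_\Gamma I_\Gamma(q_1,\dots,q_{3g-3}),$$ where $\Gamma$ runs over the Feynman graphs of genus $g$ without loops. More precisely, for each such $\Gamma$, $$I_\Gamma(q_1,\dots,q_{3g-3})=\sum_{\underline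 a}N^{\mathrm{trop}}_{\underline a,\Gamma}\,q^{2\underline a},$$ that is, the coefficient of $q^{2\underline a}$ in $I_\Gamma$ is $N^{\mathrm{trop}}_{\underline a,\Gamma}$ (and monomials that are not of the form $q^{2\underline a}$ do not occur). The same holds if $F_g$ and the sum over $\Gamma$ are taken over all labelings of all Feynman graphs instead of one reference labeling for each. -/

import Mathlib

open scoped BigOperators

noncomputable section

namespace TropicalMirror

/-! ### Feynman graphs -/

/-- A graph with `2g-2` vertices labeled by `Fin (2g-2)` and `3g-3` edges labeled by `Fin (3g-3)`;
the edge `q_k` joins the two (possibly equal) vertices in `Γ k`. A label-preserving isomorphism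
of such graphs is an equality. -/
abbrev LabeledGraph (g : ℕ) : Type := Fin (3 * g - 3) → Sym2 (Fin (2 * g - 2))

namespace LabeledGraph

variable {g : ℕ}

/-- The valence of a vertex; a loop counts twice. -/
def valence (Γ : LabeledGraph g) (v : Fin (2 * g - 2)) : ℕ :=
  ∑ k, (Γ k).toMultiset.count v

/-- Two vertices are neighbours if some edge joins them. -/
def toSimpleGraph (Γ : LabeledGraph g) : SimpleGraph (Fin (2 * g - 2)) :=
  SimpleGraph.fromRel fun u v => ∃ k, Γ k = s(u, v)

/-- Trivalent connected graphs. With `2g-2` vertices and `3g-3` edges, the first Betti number of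
a connected graph is `g`; conversely a trivalent connected graph with first Betti number `g > 1`
has `2g-2` vertices and `3g-3` edges. -/
structure IsFeynman (Γ : LabeledGraph g) : Prop where
  trivalent : ∀ v, Γ.valence v = 3
  connected : Γ.toSimpleGraph.Connected

/-- No edge joins a vertex to itself. -/
def Loopless (Γ : LabeledGraph g) : Prop := ∀ k, ¬ (Γ k).IsDiag

/-- Isomorphism of the underlying graphs, forgetting the labels. -/
def UnlabeledIso (Γ Γ' : LabeledGraph g) : Prop :=
  ∃ (σ : Equiv.Perm (Fin (2 * g - 2))) (ρ : Equiv.Perm (Fin (3 * g - 3))),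
    ∀ k, Γ' (ρ k) = (Γ k).map σ

/-- A choice of one reference labeling for every (unlabeled) Feynman graph of genus `g`. -/
structure IsReferenceSystem (R : Finset (LabeledGraph g)) : Prop where
  isFeynman : ∀ Γ ∈ R, IsFeynman Γ
  existsUnique : ∀ Γ : LabeledGraph g, IsFeynman Γ → ∃! Γ', Γ' ∈ R ∧ UnlabeledIso Γ Γ'

end LabeledGraph

/-! ### Tropical curves and labeled tropical covers -/

/-- A tropical curve of genus `g` with labeled vertices and edges: a connected trivalent graph with
a positive length on each edge. The edge `k` is parametrized by `[0, len k]`, running from `src k`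
to `tgt k`; the direction of the parametrization is auxiliary, isomorphisms may reverse it. -/
structure TropicalCurve (g : ℕ) where
  src : Fin (3 * g - 3) → Fin (2 * g - 2)
  tgt : Fin (3 * g - 3) → Fin (2 * g - 2)
  len : Fin (3 * g - 3) → ℝ
  len_pos : ∀ k, 0 < len k
  isFeynman : LabeledGraph.IsFeynman (fun k => s(src k, tgt k) : LabeledGraph g)

namespace TropicalCurve

variable {g : ℕ} (C : TropicalCurve g)

/-- The combinatorial type together with the labels. -/
def combType : LabeledGraph g := fun k => s(C.src k, C.tgt k)

/-- The start of the edge `k` as an element of its parameter interval. -/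
def start (k : Fin (3 * g - 3)) : Set.Icc (0 : ℝ) (C.len k) :=
  ⟨0, le_refl _, (C.len_pos k).le⟩

/-- The end of the edge `k` as an element of its parameter interval. -/
def finish (k : Fin (3 * g - 3)) : Set.Icc (0 : ℝ) (C.len k) :=
  ⟨C.len k, (C.len_pos k).le, le_refl _⟩

/-- Vertices and edges before gluing. -/
abbrev Pieces : Type := Fin (2 * g - 2) ⊕ (Σ k : Fin (3 * g - 3), Set.Icc (0 : ℝ) (C.len k))

/-- The ends of each edge are glued to its end vertices. -/
inductive Glue : C.Pieces → C.Pieces → Prop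
  | start (k : Fin (3 * g - 3)) : Glue (Sum.inr ⟨k, C.start k⟩) (Sum.inl (C.src k))
  | finish (k : Fin (3 * g - 3)) : Glue (Sum.inr ⟨k, C.finish k⟩) (Sum.inl (C.tgt k))

/-- The topological space underlying the metric graph. -/
def Point : Type := Quot C.Glue

instance : TopologicalSpace C.Point := inferInstanceAs (TopologicalSpace (Quot C.Glue))

/-- The vertex `x_v` as a point of the curve. -/
def vertex (v : Fin (2 * g - 2)) : C.Point := Quot.mk _ (Sum.inl v)

/-- The point with parameter `t` on the edge `q_k`. -/
def edgePoint (k : Fin (3 * g - 3)) (t : Set.Icc (0 : ℝ) (C.len k)) : C.Point :=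
  Quot.mk _ (Sum.inr ⟨k, t⟩)

/-- The vertex from which a ray emanates: the rays are the two ends of each edge,
`(k, false)` at `src k` and `(k, true)` at `tgt k`. -/
def rayVertex (r : Fin (3 * g - 3) × Bool) : Fin (2 * g - 2) :=
  if r.2 then C.tgt r.1 else C.src r.1

end TropicalCurve

/-- The slope of a ray in the direction pointing away from its vertex, where `s k` is the slope of
the edge `k` in the direction of its parametrization. -/
def raySlope {m : ℕ} (s : Fin m → ℤ) (r : Fin m × Bool) : ℤ :=
  if r.2 then - s r.1 else s r.1

/-- A tropical cover, with labels, of the tropical elliptic curve `ℝ / L ℤ`. -/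
structure LabeledCover (g : ℕ) (L : ℝ) where
  curve : TropicalCurve g
  map : curve.Point → AddCircle L
  continuous_map : Continuous map
  nonconstant : ∃ x y, map x ≠ map y
  /-- The slope of the map on each edge; it is determined by the map. -/
  slope : Fin (3 * g - 3) → ℤ
  affine : ∀ k t, map (curve.edgePoint k t)
    = map (curve.edgePoint k (curve.start k)) + (((slope k : ℝ) * (t : ℝ) : ℝ) : AddCircle L)
  /-- At each vertex, the weights of the rays mapping to one side of its image and the weights of
  the rays mapping to the other side have the same sum. -/
  balanced : ∀ v,
    ∑ r with curve.rayVertex r = v ∧ 0 < raySlope slope r, (raySlope slope r).natAbs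
      = ∑ r with curve.rayVertex r = v ∧ raySlope slope r < 0, (raySlope slope r).natAbs

namespace LabeledCover

variable {g : ℕ} {L : ℝ}

/-- The weight of an edge. -/
def weight (c : LabeledCover g L) (k : Fin (3 * g - 3)) : ℕ := (c.slope k).natAbs

/-- The preimages of `x` on the edge `q_k`. -/
def fiber (c : LabeledCover g L) (k : Fin (3 * g - 3)) (x : AddCircle L) : Set c.curve.Point :=
  {P | c.map P = x ∧ P ∈ Set.range (c.curve.edgePoint k)}

/-- Every point that is not the image of a vertex has `d` preimages, counted with the weights of
the edges on which they lie. -/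
def HasDegree (c : LabeledCover g L) (d : ℕ) : Prop :=
  ∀ x : AddCircle L, (∀ v, c.map (c.curve.vertex v) ≠ x) →
    ∑ k, (c.fiber k x).ncard * c.weight k = d

/-- The multiplicity with which a labeled cover is counted. -/
def mult (c : LabeledCover g L) : ℕ := ∏ k, c.weight k

/-- Isomorphism of labeled covers: a homeomorphism of the source curves that maps the vertex `x_v`
to `x_v` and the edge `q_k` isometrically to `q_k`, and is compatible with the maps to the
elliptic curve. -/
def Iso (c c' : LabeledCover g L) : Prop :=
  ∃ φ : c.curve.Point ≃ₜ c'.curve.Point,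
    (∀ v, φ (c.curve.vertex v) = c'.curve.vertex v) ∧
    (∀ k, ∃ ι : Set.Icc (0 : ℝ) (c.curve.len k) ≃ᵢ Set.Icc (0 : ℝ) (c'.curve.len k),
      ∀ t, φ (c.curve.edgePoint k t) = c'.curve.edgePoint k (ι t)) ∧
    ∀ P, c'.map (φ P) = c.map P

instance isoSetoid (g : ℕ) (L : ℝ) : Setoid (LabeledCover g L) where
  r := Iso
  iseqv := by
    refine ⟨fun c => ⟨Homeomorph.refl _, fun _ => rfl, fun k => ⟨IsometryEquiv.refl _, fun _ => rfl⟩,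
      fun _ => rfl⟩, ?_, ?_⟩
    · rintro c c' ⟨φ, hv, he, hm⟩
      refine ⟨φ.symm, fun v => by rw [← hv v, φ.symm_apply_apply], fun k => ?_, fun P => ?_⟩
      · obtain ⟨ι, hι⟩ := he k
        refine ⟨ι.symm, fun t => ?_⟩
        rw [φ.symm_apply_eq, hι, ι.apply_symm_apply]
      · rw [← hm, φ.apply_symm_apply]
    · rintro c c' c'' ⟨φ, hv, he, hm⟩ ⟨φ', hv', he', hm'⟩
      refine ⟨φ.trans φ', fun v => by simp [hv, hv'], fun k => ?_, fun P => by simp [hm, hm']⟩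
      obtain ⟨ι, hι⟩ := he k
      obtain ⟨ι', hι'⟩ := he' k
      exact ⟨ι.trans ι', fun t => by simp [hι, hι']⟩

theorem map_sub (c : LabeledCover g L) (k : Fin (3 * g - 3))
    (t u : Set.Icc (0 : ℝ) (c.curve.len k)) :
    c.map (c.curve.edgePoint k t) - c.map (c.curve.edgePoint k u)
      = (((c.slope k : ℝ) * ((t : ℝ) - u) : ℝ) : AddCircle L) := by
  rw [c.affine k t, c.affine k u, mul_sub, AddCircle.coe_sub]
  abel

theorem weight_eq_of_iso [hL : Fact (0 < L)] {c c' : LabeledCover g L} (h : Iso c c')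
    (k : Fin (3 * g - 3)) : c.weight k = c'.weight k := by
  obtain ⟨φ, -, he, hm⟩ := h
  obtain ⟨ι, hι⟩ := he k
  have hL0 : 0 < L := hL.out
  set M : ℝ := 2 * (|(c.slope k : ℝ)| + |(c'.slope k : ℝ)| + 1) with hM
  have hMpos : 0 < M := by positivity
  obtain ⟨ε, hε0, hε1, hε2⟩ : ∃ ε : ℝ, 0 < ε ∧ ε ≤ c.curve.len k ∧ ε * M ≤ L := by
    refine ⟨min (c.curve.len k) (L / M), lt_min (c.curve.len_pos k) (by positivity),
      min_le_left _ _, ?_⟩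
    calc min (c.curve.len k) (L / M) * M ≤ L / M * M := by gcongr; exact min_le_right _ _
      _ = L := by field_simp
  let t : Set.Icc (0 : ℝ) (c.curve.len k) := ⟨ε, hε0.le, hε1⟩
  have h1 := c.map_sub k t (c.curve.start k)
  have h2 := c'.map_sub k (ι t) (ι (c.curve.start k))
  rw [← hι, ← hι, hm, hm, h1] at h2
  have hd : |((ι t : ℝ) - (ι (c.curve.start k) : ℝ))| = ε := by
    have := ι.dist_eq t (c.curve.start k)
    rw [Subtype.dist_eq, Subtype.dist_eq, Real.dist_eq, Real.dist_eq] at this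
    rw [this]
    simp [t, TropicalCurve.start, abs_of_pos hε0]
  have h0 : |((t : ℝ) - (c.curve.start k : ℝ))| = ε := by
    simp [t, TropicalCurve.start, abs_of_pos hε0]
  have hb : ∀ x : ℝ, |x| ≤ L / 2 → ‖(x : AddCircle L)‖ = |x| := fun x hx =>
    (AddCircle.norm_coe_eq_abs_iff L hL0.ne').2 (by rwa [abs_of_pos hL0])
  have h3 := congrArg norm h2
  have hs := abs_nonneg (c.slope k : ℝ)
  have hs' := abs_nonneg (c'.slope k : ℝ)
  rw [hb _ (by rw [abs_mul, h0]; nlinarith), hb _ (by rw [abs_mul, hd]; nlinarith),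
    abs_mul, abs_mul, h0, hd] at h3
  have h4 := mul_right_cancel₀ hε0.ne' h3
  unfold weight
  have h5 : |c.slope k| = |c'.slope k| := by exact_mod_cast h4
  exact Int.natAbs_eq_natAbs_iff.2 (abs_eq_abs.1 h5)

/-- Labeled tropical covers up to isomorphism. -/
abbrev IsoClass (g : ℕ) (L : ℝ) : Type := Quotient (isoSetoid g L)

/-- The multiplicity of an isomorphism class. -/
def IsoClass.mult [Fact (0 < L)] (x : IsoClass g L) : ℕ :=
  Quotient.lift LabeledCover.mult
    (fun _ _ h => Finset.prod_congr rfl fun k _ => weight_eq_of_iso h k) x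

/-- The cover has its branch points at the points `p i`, branch type `a` at `p₀`, and the
corresponding degree. -/
structure HasBranchType (c : LabeledCover g L) (p₀ : AddCircle L)
    (p : Fin (2 * g - 2) → AddCircle L) (a : Fin (3 * g - 3) → ℕ) : Prop where
  branchPoints : Set.range (fun v => c.map (c.curve.vertex v)) = Set.range p
  degree : c.HasDegree (∑ k, a k)
  branchType : ∀ k, (c.fiber k p₀).ncard * c.weight k = a k

/-- The isomorphism classes of labeled covers of branch type `a` whose combinatorial type (with
labels) lies in `S`. -/
def classes (p₀ : AddCircle L) (p : Fin (2 * g - 2) → AddCircle L)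
    (S : Set (LabeledGraph g)) (a : Fin (3 * g - 3) → ℕ) : Set (IsoClass g L) :=
  {x | ∃ c : LabeledCover g L, ⟦c⟧ = x ∧ c.curve.combType ∈ S ∧ c.HasBranchType p₀ p a}

end LabeledCover

/-- The weighted number of labeled tropical covers of branch type `a`, with the prescribed branch
points, whose combinatorial type lies in `S`: this is `N_{a,Γ}` for `S = {Γ}`, and `N_{a,g}` if `S`
is the set of all Feynman graphs of genus `g`. -/
def tropCount {g : ℕ} {L : ℝ} [Fact (0 < L)] (p₀ : AddCircle L)
    (p : Fin (2 * g - 2) → AddCircle L) (S : Set (LabeledGraph g)) (a : Fin (3 * g - 3) → ℕ) : ℕ :=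
  ∑ᶠ x ∈ LabeledCover.classes p₀ p S a, LabeledCover.IsoClass.mult x

/-! ### The propagator and Feynman integrals -/

/-- The periods `1, τ`. -/
def periodPair (τ : UpperHalfPlane) : PeriodPair where
  ω₁ := 1
  ω₂ := τ
  indep := by
    rw [LinearIndependent.pair_iff]
    intro s t h
    have him := congrArg Complex.im h
    have hre := congrArg Complex.re h
    have hτ : (τ : ℂ).im ≠ 0 := τ.im_pos.ne'
    simp at him hre
    have ht : t = 0 := him.resolve_right (by simpa using hτ)
    subst ht
    simpa using hre

/-- The coordinate `q = exp(iπτ)` on the punctured unit disc. -/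
def qCoord (τ : UpperHalfPlane) : ℂ := Complex.exp (Complex.I * Real.pi * τ)

/-- `E₂(q) = 1 - 24 ∑_{d ≥ 1} σ(d) q^d`. -/
def eisensteinE2 (q : ℂ) : ℂ :=
  1 - 24 * ∑' d : ℕ, (ArithmeticFunction.sigma 1 (d + 1) : ℂ) * q ^ (d + 1)

/-- The propagator `P(z,q) = ℘(z,q) / (4π²) + E₂(q²) / 12` at `q = exp(iπτ)`, where `℘(·,q)` is the
Weierstrass function of the lattice `ℤ + ℤτ`. -/
def propagator (z : ℂ) (τ : UpperHalfPlane) : ℂ :=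
  1 / (4 * Real.pi ^ 2) * (periodPair τ).weierstrassP z + 1 / 12 * eisensteinE2 (qCoord τ ^ 2)

theorem propagator_neg (z : ℂ) (τ : UpperHalfPlane) : propagator (-z) τ = propagator z τ := by
  simp [propagator]

/-- The factor `-P(z_i - z_j, q_k)` of an edge with end vertices `x_i`, `x_j`. -/
def edgeFactor {n : ℕ} (z : Fin n → ℂ) (τ : UpperHalfPlane) (e : Sym2 (Fin n)) : ℂ :=
  Sym2.lift ⟨fun i j => - propagator (z i - z j) τ, fun i j => by
    show - propagator (z i - z j) τ = - propagator (z j - z i) τ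
    rw [← propagator_neg, neg_sub]⟩ e

/-- The integrand `∏_k (-P_k)` at the points `z_j = i y_j + t_j` of the integration paths. -/
def integrand {g : ℕ} (Γ : LabeledGraph g) (τ : Fin (3 * g - 3) → UpperHalfPlane)
    (y t : Fin (2 * g - 2) → ℝ) : ℂ :=
  ∏ k, edgeFactor (fun j => Complex.I * y j + t j) (τ k) (Γ k)

/-- The integral of `∏_k (-P_k)` over the paths `γ_j : [0,1] → ℂ, t ↦ i y_j + t`. -/
def feynmanIntegralAt {g : ℕ} (Γ : LabeledGraph g) (τ : Fin (3 * g - 3) → UpperHalfPlane)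
    (y : Fin (2 * g - 2) → ℝ) : ℂ :=
  ∫ t in Set.Icc (0 : Fin (2 * g - 2) → ℝ) 1, integrand Γ τ y t

/-- Starting points `i y_j` of the integration paths for the vertex order in which `x_j` is at
position `Ω j`. They are so small that every difference `z_i - z_j` stays in the strip
`|Im z| < Im τ_k`, where the only poles of the propagator are the integers. -/
structure IsStart {g : ℕ} (τ : Fin (3 * g - 3) → UpperHalfPlane)
    (Ω : Equiv.Perm (Fin (2 * g - 2))) (y : Fin (2 * g - 2) → ℝ) : Prop where
  order : ∀ i j, Ω i < Ω j → y i < y j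
  small : ∀ i j k, |y i - y j| < (τ k).im

/-- The refined Feynman integral `I_Γ = ∑_Ω I_{Γ,Ω}`, computed with the starting points
`y Ω` for the order `Ω`. -/
def feynmanIntegral {g : ℕ} (Γ : LabeledGraph g) (τ : Fin (3 * g - 3) → UpperHalfPlane)
    (y : Equiv.Perm (Fin (2 * g - 2)) → Fin (2 * g - 2) → ℝ) : ℂ :=
  ∑ Ω, feynmanIntegralAt Γ τ (y Ω)

/-- The monomial `q^{2a}`. -/
def qMonomial {m : ℕ} (τ : Fin m → UpperHalfPlane) (a : Fin m → ℕ) : ℂ :=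
  ∏ k, qCoord (τ k) ^ (2 * a k)

end TropicalMirror

end

/-!
For `0 < Im z < Im τ` the factor `-P(z, q)` of an edge is the sum of
`w q^{2 w |n|} exp(2πi (± w) z)` over all weights `w ≥ 1` and winding numbers `n ∈ ℤ`, where the
sign is that of `n`. In the product over the edges, a choice of one summand for each edge
contributes the exponential of an integral linear form in the `z_j`, which is annihilated by the
integration over the real parts unless the signed weights are balanced at every vertex. What remains
is a sum over balanced families of strands `(n_k, w_k)`, each contributing
`∏_k w_k q_k^{2 w_k |n_k|}`.

On the other side, cut the elliptic curve at `p₀`. The positions of the branch points on the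
resulting interval turn a labeled cover into an order `Ω` of its vertices, and its edges, oriented
along `Ω`, are determined by their slopes and by how often they wind around the circle. The edge
`q_k` meets the fiber of `p₀` in `|n_k|` points of weight `w_k`, so the isomorphism classes of
covers of branch type `a` are exactly the pairs of an order and a balanced family of strands with
`w_k |n_k| = a_k`.
-/

namespace TropicalMirror

/-! ### The expansion of the propagator -/

/-- A path that winds around the elliptic curve with constant speed, recorded by its winding number
`d.1 : ℤ` and its weight `d.2 : ℕ+`. The edges of a labeled cover will be strands: the winding
number counts the crossings of the base point, with sign. -/
abbrev Strand : Type := ℤ × ℕ+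

namespace Strand

/-- The slope of a strand: its weight, with the sign of the winding number. The sign of the winding
number `0` is taken to be positive, since edges will be oriented along the vertex order. -/
def slope (d : Strand) : ℤ := if 0 ≤ d.1 then (d.2 : ℤ) else -(d.2 : ℤ)

/-- The number of preimages of the base point on a strand, counted with the weight. -/
def degree (d : Strand) : ℕ := d.2 * d.1.natAbs

theorem natAbs_slope (d : Strand) : d.slope.natAbs = d.2 := by
  unfold slope
  split_ifs <;> simp

theorem slope_ne_zero (d : Strand) : d.slope ≠ 0 := by
  rw [← Int.natAbs_ne_zero, natAbs_slope]
  exact d.2.ne_zero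

theorem slope_mul_winding (d : Strand) : d.slope * d.1 = d.degree := by
  unfold slope degree
  split_ifs with h
  · rw [Nat.cast_mul, Int.natAbs_of_nonneg h]
  · rw [Nat.cast_mul, Int.ofNat_natAbs_of_nonpos (by lia), neg_mul_comm]

end Strand

/-- The summand `w q^{2 w |n|} exp(2πi (± w) z)` of the expansion of `-P(z, q)` that belongs to the
strand with winding number `n` and weight `w`. -/
noncomputable def strandTerm (τ : UpperHalfPlane) (z : ℂ) (d : Strand) : ℂ :=
  (d.2 : ℂ) * qCoord τ ^ (2 * d.degree) * Complex.exp (2 * Real.pi * Complex.I * (d.slope * z))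

theorem qCoord_pow_two_mul (τ : UpperHalfPlane) (n : ℕ) :
    qCoord τ ^ (2 * n) = Complex.exp (2 * Real.pi * Complex.I * (n * τ)) := by
  rw [qCoord, ← Complex.exp_nat_mul]
  push_cast
  ring_nf

theorem strandTerm_eq_exp (τ : UpperHalfPlane) (z : ℂ) (d : Strand) :
    strandTerm τ z d
      = (d.2 : ℂ) * Complex.exp (2 * Real.pi * Complex.I * (d.slope * (z + d.1 * τ))) := by
  have hdegree : (d.degree : ℂ) = d.slope * d.1 := by exact_mod_cast d.slope_mul_winding.symm
  rw [strandTerm, qCoord_pow_two_mul, mul_assoc, ← Complex.exp_add, hdegree]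
  ring_nf

theorem Strand.le_slope_mul {δ x t : ℝ} (hδ : 0 ≤ δ) (hx : δ ≤ x) (hxt : δ ≤ t - x) (d : Strand) :
    δ / 2 * (d.1.natAbs + (d.2 : ℕ)) ≤ d.slope * (x + d.1 * t) := by
  obtain ⟨n, w⟩ := d
  have hw : (1 : ℝ) ≤ (w : ℕ) := by exact_mod_cast w.pos
  rcases le_or_gt 0 n with hn | hn
  · lift n to ℕ using hn
    have hbound : δ * (1 + n) ≤ x + n * t := by nlinarith [n.cast_nonneg (α := ℝ)]
    have hprod := mul_le_mul_of_nonneg_left hbound (zero_le_one.trans hw)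
    simp only [slope, Int.natCast_nonneg, if_true, Int.natAbs_natCast, Int.cast_natCast]
    nlinarith [mul_nonneg hδ n.cast_nonneg, mul_nonneg (mul_nonneg hδ n.cast_nonneg)
      (sub_nonneg.2 hw)]
  · obtain ⟨m, rfl⟩ : ∃ m : ℕ, n = -((m : ℤ) + 1) := ⟨(-n - 1).toNat, by lia⟩
    have hbound : δ * (1 + m) ≤ (m + 1) * t - x := by nlinarith [m.cast_nonneg (α := ℝ)]
    have hprod := mul_le_mul_of_nonneg_left hbound (zero_le_one.trans hw)
    simp only [slope, not_le.2 hn, if_false, show (-((m : ℤ) + 1)).natAbs = m + 1 by lia]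
    push_cast
    nlinarith [mul_nonneg hδ m.cast_nonneg, mul_nonneg (mul_nonneg hδ m.cast_nonneg)
      (sub_nonneg.2 hw)]

theorem norm_strandTerm_le {τ : UpperHalfPlane} {z : ℂ} {δ : ℝ} (hδ : 0 ≤ δ) (h0 : δ ≤ z.im)
    (h1 : δ ≤ τ.im - z.im) (d : Strand) :
    ‖strandTerm τ z d‖
      ≤ Real.exp (-(Real.pi * δ)) ^ d.1.natAbs * (d.2 * Real.exp (-(Real.pi * δ)) ^ (d.2 : ℕ)) := by
  have him := Strand.le_slope_mul hδ h0 h1 d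
  have hre : (2 * Real.pi * Complex.I * (d.slope * (z + d.1 * τ))).re
      = -(2 * Real.pi * (d.slope * (z.im + d.1 * τ.im))) := by simp
  rw [strandTerm_eq_exp, norm_mul, Complex.norm_natCast, Complex.norm_exp, hre,
    mul_left_comm (Real.exp _ ^ _), ← pow_add, ← Real.exp_nat_mul]
  gcongr
  push_cast
  nlinarith [Real.pi_pos]

theorem summable_norm_strandTerm (τ : UpperHalfPlane) {z : ℂ} (h0 : 0 < z.im) (h1 : z.im < τ.im) :
    Summable fun d => ‖strandTerm τ z d‖ := by
  obtain ⟨δ, hδ, hδ0, hδ1⟩ : ∃ δ > 0, δ ≤ z.im ∧ δ ≤ τ.im - z.im :=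
    ⟨min z.im (τ.im - z.im), lt_min h0 (by linarith), min_le_left _ _, min_le_right _ _⟩
  set r := Real.exp (-(Real.pi * δ))
  have hr0 : 0 ≤ r := (Real.exp_pos _).le
  have hr1 : r < 1 := Real.exp_lt_one_iff.2 (neg_neg_of_pos (mul_pos Real.pi_pos hδ))
  have hwinding : Summable fun n : ℤ => r ^ n.natAbs := by
    refine Summable.of_nat_of_neg ?_ ?_ <;> simpa using summable_geometric_of_lt_one hr0 hr1
  have hweight : Summable fun w : ℕ+ => (w : ℝ) * r ^ (w : ℕ) := by
    have hnat := summable_pow_mul_geometric_of_norm_lt_one (R := ℝ) (r := r) 1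
      (by rwa [Real.norm_of_nonneg hr0])
    simpa only [pow_one] using! hnat.comp_injective PNat.coe_injective
  exact .of_nonneg_of_le (fun _ => norm_nonneg _) (norm_strandTerm_le hδ.le hδ0 hδ1)
    (hwinding.mul_of_nonneg hweight (fun _ => by positivity) fun _ => by positivity)

theorem hasSum_one_div_add_int_sq {u : ℂ} (hu : 0 < u.im) :
    HasSum (fun k : ℤ => 1 / (u + k) ^ 2)
      (-(4 * Real.pi ^ 2)
        * ∑' w : ℕ+, (w : ℂ) * Complex.exp (2 * Real.pi * Complex.I * (w * u))) := by
  have hsummable : Summable fun k : ℤ => 1 / (u + k) ^ 2 := by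
    simpa using! EisensteinSeries.linear_right_summable u 1 (k := 2) le_rfl
  have hlipschitz := EisensteinSeries.qExpansion_identity_pnat (k := 1) le_rfl ⟨u, hu⟩
  simp only [Nat.reduceAdd, Nat.factorial_one, Nat.cast_one, div_one, pow_one] at hlipschitz
  rw [show ((-2 * Real.pi * Complex.I) ^ 2 : ℂ) = -(4 * Real.pi ^ 2) by
    rw [mul_pow, Complex.I_sq]; ring] at hlipschitz
  simp_rw [mul_left_comm (2 * Real.pi * Complex.I), Complex.exp_nat_mul]
  exact hlipschitz ▸ hsummable.hasSum

theorem hasSum_one_div_add_winding_sq (τ : UpperHalfPlane) {z : ℂ} (h0 : 0 < z.im)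
    (h1 : z.im < τ.im) (n : ℤ) :
    HasSum (fun k : ℤ => 1 / (z + n * τ + k) ^ 2)
      (-(4 * Real.pi ^ 2) * ∑' w : ℕ+, strandTerm τ z (n, w)) := by
  have him : (z + n * τ).im = z.im + n * τ.im := by simp
  simp_rw [strandTerm_eq_exp, Strand.slope]
  rcases le_or_gt 0 n with hn | hn
  · have hpos : 0 < (z + n * τ).im := by
      have : (0 : ℝ) ≤ n := by exact_mod_cast hn
      rw [him]
      exact add_pos_of_pos_of_nonneg h0 (mul_nonneg this τ.im_pos.le)
    simpa only [hn, if_true, Int.cast_natCast] using hasSum_one_div_add_int_sq hpos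
  · have hpos : 0 < (-(z + n * τ)).im := by
      have : (n : ℝ) ≤ -1 := by exact_mod_cast Int.le_sub_one_of_lt hn
      rw [Complex.neg_im, him]
      nlinarith [τ.im_pos]
    have hneg := (Equiv.neg ℤ).hasSum_iff.2 (hasSum_one_div_add_int_sq hpos)
    simp only [not_le.2 hn, if_false, Int.cast_neg, Int.cast_natCast, neg_mul_comm _ (z + n * τ)]
    refine hneg.congr_fun fun k => ?_
    simp only [Function.comp_apply, Equiv.neg_apply, Int.cast_neg, ← neg_add, neg_sq]

theorem hasSum_weierstrassP_sub (τ : UpperHalfPlane) (z : ℂ) :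
    HasSum (fun l : ℤ × ℤ => 1 / (z + l.1 * τ + l.2) ^ 2 - 1 / ((l.1 * τ + l.2 : ℂ)) ^ 2)
      ((periodPair τ).weierstrassP z) := by
  have h := (periodPair τ).hasSum_weierstrassP (-z)
  rw [PeriodPair.weierstrassP_neg, ← (periodPair τ).latticeEquivProd.symm.toEquiv.hasSum_iff,
    ← (Equiv.prodComm ℤ ℤ).hasSum_iff] at h
  refine h.congr_fun fun l => ?_
  have hl : (((periodPair τ).latticeEquivProd.symm (l.2, l.1) : (periodPair τ).lattice) : ℂ)
      = l.1 * τ + l.2 := by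
    rw [PeriodPair.latticeEquiv_symm_apply]
    simp only [periodPair, mul_one]
    ring
  change _ = 1 / (-z - ((periodPair τ).latticeEquivProd.symm (l.2, l.1) : ℂ)) ^ 2
    - 1 / ((periodPair τ).latticeEquivProd.symm (l.2, l.1) : ℂ) ^ 2
  rw [hl, add_assoc, ← neg_add', neg_sq]

theorem hasSum_one_div_lattice_row (τ : UpperHalfPlane) (n : ℤ) :
    HasSum (fun k : ℤ => 1 / ((n * τ + k : ℂ)) ^ 2) (EisensteinSeries.e2Summand n τ) := by
  refine (EisensteinSeries.e2Summand_summable n τ).hasSum.congr_fun fun k => ?_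
  simp only [EisensteinSeries.eisSummand, Matrix.cons_val_zero, Matrix.cons_val_one]
  rw [zpow_neg, one_div]
  norm_cast

theorem hasSum_weierstrassP_rows (τ : UpperHalfPlane) {z : ℂ} (h0 : 0 < z.im)
    (h1 : z.im < τ.im) :
    HasSum (fun n : ℤ => -(4 * Real.pi ^ 2) * ∑' w : ℕ+, strandTerm τ z (n, w)
        - EisensteinSeries.e2Summand n τ) ((periodPair τ).weierstrassP z) :=
  (hasSum_weierstrassP_sub τ z).prod_fiberwise fun n =>
    (hasSum_one_div_add_winding_sq τ h0 h1 n).sub (hasSum_one_div_lattice_row τ n)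

theorem tsum_e2Summand {τ : UpperHalfPlane}
    (h : Summable fun n : ℤ => EisensteinSeries.e2Summand n τ) :
    ∑' n : ℤ, EisensteinSeries.e2Summand n τ
      = Real.pi ^ 2 / 3 * eisensteinE2 (qCoord τ ^ 2) := by
  have hsym : HasSum (fun n : ℤ => EisensteinSeries.e2Summand n τ)
      (∑' n : ℤ, EisensteinSeries.e2Summand n τ) (SummationFilter.symmetricIcc ℤ) :=
    h.hasSum.mono_left SummationFilter.LeAtTop.le_atTop
  have hq : qCoord τ ^ 2 = Complex.exp (2 * Real.pi * Complex.I * τ) := by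
    simpa using qCoord_pow_two_mul τ 1
  rw [hsym.unique (EisensteinSeries.hasSum_e2Summand_symmetricIcc τ), riemannZeta_two,
    tsum_pnat_eq_tsum_succ (f := fun n : ℕ => (ArithmeticFunction.sigma 1 n : ℂ)
      * Complex.exp (2 * Real.pi * Complex.I * τ) ^ n), eisensteinE2, hq]
  ring

theorem hasSum_strandTerm (τ : UpperHalfPlane) {z : ℂ} (h0 : 0 < z.im) (h1 : z.im < τ.im) :
    HasSum (strandTerm τ z) (-propagator z τ) := by
  have hstrand := (summable_norm_strandTerm τ h0 h1).of_norm
  have hrows := hasSum_weierstrassP_rows τ h0 h1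
  have hweights := hstrand.prod.mul_left (-(4 * (Real.pi : ℂ) ^ 2))
  have he2 : Summable fun n : ℤ => EisensteinSeries.e2Summand n τ :=
    (hweights.sub hrows.summable).congr fun n => by ring
  have hP := hrows.tsum_eq
  rw [hweights.tsum_sub he2, tsum_mul_left, ← hstrand.tsum_prod, tsum_e2Summand he2] at hP
  suffices hsum : -propagator z τ = ∑' d, strandTerm τ z d from hsum ▸ hstrand.hasSum
  have hpi : (Real.pi : ℂ) ≠ 0 := by exact_mod_cast Real.pi_ne_zero
  rw [propagator, ← hP]
  field_simp
  ring

/-! ### Termwise integration -/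

theorem summable_norm_prod_and_hasSum_prod {R ι : Type*} [NormedCommRing R] [CompleteSpace R]
    {m : ℕ} {F : Fin m → ι → R} {a : Fin m → R} (hF : ∀ k, HasSum (F k) (a k))
    (hnorm : ∀ k, Summable fun i => ‖F k i‖) :
    (Summable fun f : Fin m → ι => ‖∏ k, F k (f k)‖) ∧
      HasSum (fun f : Fin m → ι => ∏ k, F k (f k)) (∏ k, a k) := by
  induction m with
  | zero =>
    simp only [Fin.prod_univ_zero]
    exact ⟨(hasSum_unique _).summable, hasSum_unique fun _ : Fin 0 → ι => (1 : R)⟩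
  | succ m ih =>
    obtain ⟨hsummable, hsum⟩ := ih (F := fun k => F k.succ) (a := fun k => a k.succ)
      (fun k => hF k.succ) fun k => hnorm k.succ
    have hmul := (hnorm 0).mul_norm hsummable
    rw [← (Fin.consEquiv fun _ => ι).summable_iff, ← (Fin.consEquiv fun _ => ι).hasSum_iff,
      Fin.prod_univ_succ]
    refine ⟨hmul.congr fun x => ?_,
      ((hF 0).mul hsum hmul.of_norm).congr_fun fun x => ?_⟩ <;>
    simp [Fin.consEquiv, Fin.prod_univ_succ]

section Flow

variable {E V : Type*} [Fintype E] [DecidableEq V]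

/-- The net inflow at the vertex `v` of the flow that sends `s k` along the edge `k`, from `src k`
to `tgt k`. -/
def netFlow (src tgt : E → V) (s : E → ℤ) (v : V) : ℤ :=
  ∑ k, s k * ((if tgt k = v then 1 else 0) - (if src k = v then 1 else 0))

theorem sum_netFlow_mul [Fintype V] {R : Type*} [CommRing R] (src tgt : E → V) (s : E → ℤ)
    (z : V → R) :
    ∑ v, (netFlow src tgt s v : R) * z v = ∑ k, (s k : R) * (z (tgt k) - z (src k)) := by
  simp only [netFlow, Int.cast_sum, Finset.sum_mul]
  rw [Finset.sum_comm]
  refine Finset.sum_congr rfl fun k _ => ?_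
  push_cast
  simp only [mul_assoc, sub_mul, ← Finset.mul_sum, Finset.sum_sub_distrib, ite_mul, one_mul,
    zero_mul, Finset.sum_ite_eq, Finset.mem_univ, if_true]

/-- Flow conservation at every vertex. -/
def IsBalanced (src tgt : E → V) (s : E → ℤ) : Prop := ∀ v, netFlow src tgt s v = 0

end Flow

/-- The point `i y_v + t_v` of the integration path that belongs to the vertex `v`. -/
noncomputable def pathPoint {V : Type*} (y t : V → ℝ) (v : V) : ℂ := Complex.I * y v + t v

section Expansion

variable {V : Type*} {m : ℕ}

/-- The integrand `∏_k (-P_k)` of a Feynman integral whose edges run from `lo k` to `hi k`. -/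
noncomputable def orientedIntegrand (τ : Fin m → UpperHalfPlane) (lo hi : Fin m → V)
    (y t : V → ℝ) : ℂ :=
  ∏ k, -propagator (pathPoint y t (hi k) - pathPoint y t (lo k)) (τ k)

/-- The summand of the expansion of `orientedIntegrand` that belongs to the strands `f`. -/
noncomputable def flowTerm (τ : Fin m → UpperHalfPlane) (lo hi : Fin m → V) (y t : V → ℝ)
    (f : Fin m → Strand) : ℂ :=
  ∏ k, strandTerm (τ k) (pathPoint y t (hi k) - pathPoint y t (lo k)) (f k)

/-- What remains of `flowTerm` after the integration if the strands `f` are balanced. -/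
noncomputable def flowCoeff (τ : Fin m → UpperHalfPlane) (f : Fin m → Strand) : ℂ :=
  (∏ k, ((f k).2 : ℂ)) * qMonomial τ fun k => (f k).degree

variable {τ : Fin m → UpperHalfPlane} {lo hi : Fin m → V} {y : V → ℝ}

theorem summable_norm_flowTerm_and_hasSum_flowTerm
    (hy : ∀ k, y (hi k) - y (lo k) ∈ Set.Ioo 0 (τ k).im) (t : V → ℝ) :
    (Summable fun f => ‖flowTerm τ lo hi y t f‖) ∧
      HasSum (flowTerm τ lo hi y t) (orientedIntegrand τ lo hi y t) := by
  have him : ∀ k, (pathPoint y t (hi k) - pathPoint y t (lo k)).im = y (hi k) - y (lo k) :=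
    fun k => by simp [pathPoint]
  exact summable_norm_prod_and_hasSum_prod
    (fun k => hasSum_strandTerm (τ k) (by simpa only [him] using (hy k).1)
      (by simpa only [him] using (hy k).2))
    fun k => summable_norm_strandTerm (τ k) (by simpa only [him] using (hy k).1)
      (by simpa only [him] using (hy k).2)

theorem norm_flowTerm_eq (t : V → ℝ) (f : Fin m → Strand) :
    ‖flowTerm τ lo hi y t f‖ = ‖flowTerm τ lo hi y 0 f‖ := by
  simp [flowTerm, strandTerm, pathPoint, Complex.norm_exp]

theorem continuous_flowTerm (f : Fin m → Strand) :
    Continuous fun t => flowTerm τ lo hi y t f := by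
  simp only [flowTerm, strandTerm, pathPoint]
  fun_prop

theorem continuous_orientedIntegrand (hy : ∀ k, y (hi k) - y (lo k) ∈ Set.Ioo 0 (τ k).im) :
    Continuous (orientedIntegrand τ lo hi y) := by
  rw [funext fun t => (summable_norm_flowTerm_and_hasSum_flowTerm hy t).2.tsum_eq.symm]
  exact continuous_tsum continuous_flowTerm (summable_norm_flowTerm_and_hasSum_flowTerm hy 0).1
    fun f t => (norm_flowTerm_eq t f).le

variable [Fintype V] [DecidableEq V]

theorem flowTerm_eq_flowCoeff_mul (t : V → ℝ) (f : Fin m → Strand) :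
    flowTerm τ lo hi y t f = flowCoeff τ f * ∏ v, Complex.exp
      (2 * Real.pi * Complex.I * (netFlow lo hi (fun k => (f k).slope) v * pathPoint y t v)) := by
  simp only [flowTerm, strandTerm, flowCoeff, qMonomial, Finset.prod_mul_distrib]
  rw [← Complex.exp_sum, ← Complex.exp_sum, ← Finset.mul_sum, ← Finset.mul_sum, sum_netFlow_mul]

theorem integral_exp_int_mul (b : ℤ) (c : ℂ) :
    ∫ t in Set.Icc (0 : ℝ) 1, Complex.exp (2 * Real.pi * Complex.I * (b * (c + t)))
      = if b = 0 then 1 else 0 := by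
  split_ifs with hb
  · simp [hb]
  · have hfactor : ∀ t : ℝ, Complex.exp (2 * Real.pi * Complex.I * (b * (c + t)))
        = Complex.exp (2 * Real.pi * Complex.I * (b * c))
          * Complex.exp (2 * Real.pi * Complex.I * b * t) := fun t => by
      rw [← Complex.exp_add]
      ring_nf
    have hperiod : Complex.exp (2 * Real.pi * Complex.I * b * (1 : ℝ)) = 1 :=
      Complex.exp_eq_one_iff.2 ⟨b, by push_cast; ring⟩
    simp_rw [hfactor]
    rw [MeasureTheory.integral_const_mul, MeasureTheory.integral_Icc_eq_integral_Ioc,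
      ← intervalIntegral.integral_of_le zero_le_one,
      integral_exp_mul_complex (by simp [Real.pi_ne_zero, hb]), hperiod]
    simp

theorem integral_prod_exp_int_mul {ι : Type*} [Fintype ι] (b : ι → ℤ) (c : ι → ℂ) :
    ∫ t in Set.Icc (0 : ι → ℝ) 1,
        ∏ v, Complex.exp (2 * Real.pi * Complex.I * (b v * (c v + t v)))
      = if ∀ v, b v = 0 then 1 else 0 := by
  have hcube : Set.Icc (0 : ι → ℝ) 1 = Set.univ.pi fun _ => Set.Icc (0 : ℝ) 1 :=
    (Set.pi_univ_Icc _ _).symm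
  rw [hcube, MeasureTheory.volume_pi, MeasureTheory.Measure.restrict_pi_pi,
    MeasureTheory.integral_fintype_prod_eq_prod (f := fun v (t : ℝ) =>
      Complex.exp (2 * Real.pi * Complex.I * (b v * (c v + t))))]
  simp_rw [integral_exp_int_mul, Finset.prod_ite_zero]
  simp

open Classical in
theorem hasSum_integral_orientedIntegrand
    (hy : ∀ k, y (hi k) - y (lo k) ∈ Set.Ioo 0 (τ k).im) :
    HasSum (fun f => if IsBalanced lo hi (fun k => (f k).slope) then flowCoeff τ f else 0)
      (∫ t in Set.Icc (0 : V → ℝ) 1, orientedIntegrand τ lo hi y t) := by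
  rw [funext fun t => (summable_norm_flowTerm_and_hasSum_flowTerm hy t).2.tsum_eq.symm]
  refine (MeasureTheory.hasSum_integral_of_summable_integral_norm
    (μ := MeasureTheory.volume.restrict (Set.Icc (0 : V → ℝ) 1)) (fun f => ?_) ?_).congr_fun
    fun f => ?_
  · exact (continuous_flowTerm f).continuousOn.integrableOn_compact isCompact_Icc
  · simp_rw [norm_flowTerm_eq]
    simpa using (summable_norm_flowTerm_and_hasSum_flowTerm hy 0).1.mul_left _
  · simp only [flowTerm_eq_flowCoeff_mul, pathPoint]
    rw [MeasureTheory.integral_const_mul, integral_prod_exp_int_mul, mul_ite, mul_one, mul_zero]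
    exact if_congr Iff.rfl rfl rfl

end Expansion

/-! ### Flows of given degree -/

section FlowCount

variable {V : Type*} [DecidableEq V] {m : ℕ}

/-- The balanced families of strands of degree `a`, one strand for each edge. -/
def flowSet (lo hi : Fin m → V) (a : Fin m → ℕ) : Set (Fin m → Strand) :=
  {f | IsBalanced lo hi (fun k => (f k).slope) ∧ ∀ k, (f k).degree = a k}

/-- The number of flows of degree `a`, each counted with the product of its weights. -/
noncomputable def flowCount (lo hi : Fin m → V) (a : Fin m → ℕ) : ℕ :=
  ∑ᶠ f ∈ flowSet lo hi a, ∏ k, ((f k).2 : ℕ)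

variable {τ : Fin m → UpperHalfPlane} {lo hi : Fin m → V} {y : V → ℝ} {a : Fin m → ℕ}

theorem qMonomial_ne_zero (τ : Fin m → UpperHalfPlane) (a : Fin m → ℕ) : qMonomial τ a ≠ 0 :=
  Finset.prod_ne_zero_iff.2 fun _ _ => pow_ne_zero _ (Complex.exp_ne_zero _)

theorem flowCoeff_of_mem {f : Fin m → Strand} (hf : f ∈ flowSet lo hi a) :
    flowCoeff τ f = (∏ k, ((f k).2 : ℕ) : ℕ) * qMonomial τ a := by
  rw [flowCoeff, funext hf.2]
  push_cast
  rfl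

theorem finite_flowSet [Finite V] (hy : ∀ k, y (lo k) < y (hi k)) (a : Fin m → ℕ) :
    (flowSet lo hi a).Finite := by
  classical
  cases nonempty_fintype V
  -- Every flow of degree `a` contributes at least `‖q^{2a}‖` to a convergent series.
  let τ : Fin m → UpperHalfPlane := fun k =>
    ⟨Complex.I * ((y (hi k) - y (lo k) + 1 : ℝ) : ℂ), by simpa using by linarith [hy k]⟩
  have hsum := hasSum_integral_orientedIntegrand (τ := τ) (lo := lo) (hi := hi) (y := y)
    fun k => ⟨sub_pos.2 (hy k), by simp [τ, UpperHalfPlane.im]⟩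
  have hq : 0 < ‖qMonomial τ a‖ := norm_pos_iff.2 (qMonomial_ne_zero τ a)
  have hfinite := hsum.summable.norm.tendsto_cofinite_zero.eventually (gt_mem_nhds hq)
  refine (Filter.eventually_cofinite.1 hfinite).subset fun f hf => ?_
  have hweights : (1 : ℝ) ≤ (∏ k, ((f k).2 : ℕ) : ℕ) := by
    exact_mod_cast Finset.one_le_prod' fun k _ => (f k).2.pos
  simpa only [Set.mem_ofPred_eq, not_lt, if_pos hf.1, flowCoeff_of_mem hf, norm_mul,
    Complex.norm_natCast] using le_mul_of_one_le_left hq.le hweights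

theorem hasSum_flowCount [Fintype V]
    (hy : ∀ k, y (hi k) - y (lo k) ∈ Set.Ioo 0 (τ k).im) :
    HasSum (fun a => (flowCount lo hi a : ℂ) * qMonomial τ a)
      (∫ t in Set.Icc (0 : V → ℝ) 1, orientedIntegrand τ lo hi y t) := by
  classical
  refine ((hasSum_integral_orientedIntegrand hy).tsum_fiberwise
    fun f k => (f k).degree).congr_fun fun a => ?_
  have hfinite := finite_flowSet (fun k => sub_pos.1 (hy k).1) a
  rw [tsum_subtype _ fun f : Fin m → Strand =>
      if IsBalanced lo hi (fun k => (f k).slope) then flowCoeff τ f else 0,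
    tsum_eq_sum (s := hfinite.toFinset), flowCount, finsum_mem_eq_finite_toFinset_sum _ hfinite,
    Nat.cast_sum, Finset.sum_mul]
  · refine Finset.sum_congr rfl fun f hf => ?_
    have hf' : f ∈ flowSet lo hi a := hfinite.mem_toFinset.1 hf
    have hdegree : f ∈ (fun (f : Fin m → Strand) k => (f k).degree) ⁻¹' {a} := funext hf'.2
    rw [Set.indicator_of_mem hdegree, if_pos hf'.1, flowCoeff_of_mem hf']
  · refine fun f hf => Set.indicator_apply_eq_zero.2 fun hdegree => if_neg fun hbalanced => hf ?_
    exact hfinite.mem_toFinset.2 ⟨hbalanced, congrFun hdegree⟩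

end FlowCount

/-! ### Points of metric graphs and isomorphisms -/

namespace TropicalCurve

variable {g : ℕ} (C C' : TropicalCurve g)

theorem edgePoint_start (k : Fin (3 * g - 3)) : C.edgePoint k (C.start k) = C.vertex (C.src k) :=
  Quot.sound (Glue.start k)

theorem edgePoint_finish (k : Fin (3 * g - 3)) :
    C.edgePoint k (C.finish k) = C.vertex (C.tgt k) :=
  Quot.sound (Glue.finish k)

theorem start_ne_finish (k : Fin (3 * g - 3)) : C.start k ≠ C.finish k := fun h =>
  (C.len_pos k).ne (congrArg Subtype.val h)

theorem continuous_edgePoint (k : Fin (3 * g - 3)) : Continuous (C.edgePoint k) :=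
  continuous_quot_mk.comp (continuous_inr.comp continuous_sigmaMk)

theorem continuous_of_continuous_edgePoint {Y : Type*} [TopologicalSpace Y] {f : C.Point → Y}
    (h : ∀ k, Continuous fun t => f (C.edgePoint k t)) : Continuous f :=
  isQuotientMap_quot_mk.continuous_iff.2
    (continuous_sum_dom.2 ⟨continuous_of_discreteTopology, continuous_sigma h⟩)

open Classical in
/-- A point of the curve is either a vertex or an interior point of an edge. -/
noncomputable def normalForm : C.Point → Fin (2 * g - 2) ⊕ Fin (3 * g - 3) × ℝ :=
  Quot.lift (Sum.elim Sum.inl fun x =>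
      if (x.2 : ℝ) = 0 then Sum.inl (C.src x.1)
      else if (x.2 : ℝ) = C.len x.1 then Sum.inl (C.tgt x.1) else Sum.inr (x.1, (x.2 : ℝ))) <| by
    rintro _ _ (k | k)
    · simp [start]
    · simp [finish, (C.len_pos k).ne']

theorem normalForm_vertex (v : Fin (2 * g - 2)) : C.normalForm (C.vertex v) = Sum.inl v := rfl

open Classical in
theorem normalForm_edgePoint (k : Fin (3 * g - 3)) (t : Set.Icc (0 : ℝ) (C.len k)) :
    C.normalForm (C.edgePoint k t) = if (t : ℝ) = 0 then Sum.inl (C.src k)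
      else if (t : ℝ) = C.len k then Sum.inl (C.tgt k) else Sum.inr (k, (t : ℝ)) := rfl

variable {C C'}

theorem edgePoint_eq_vertex {k : Fin (3 * g - 3)} {t : Set.Icc (0 : ℝ) (C.len k)}
    {v : Fin (2 * g - 2)} (h : C.edgePoint k t = C.vertex v) :
    (t = C.start k ∧ C.src k = v) ∨ (t = C.finish k ∧ C.tgt k = v) := by
  have hform := congrArg C.normalForm h
  rw [normalForm_vertex, normalForm_edgePoint] at hform
  split_ifs at hform with h0 h1
  · exact Or.inl ⟨Subtype.ext h0, Sum.inl_injective hform⟩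
  · exact Or.inr ⟨Subtype.ext h1, Sum.inl_injective hform⟩

theorem eq_of_edgePoint_eq {k : Fin (3 * g - 3)} {t u : Set.Icc (0 : ℝ) (C.len k)}
    (hstart : t ≠ C.start k) (hfinish : t ≠ C.finish k) (h : C.edgePoint k t = C.edgePoint k u) :
    t = u := by
  have hform := congrArg C.normalForm h
  rw [normalForm_edgePoint, normalForm_edgePoint,
    if_neg fun h : (t : ℝ) = 0 => hstart (Subtype.ext h),
    if_neg fun h : (t : ℝ) = C.len k => hfinish (Subtype.ext h)] at hform
  split_ifs at hform
  simpa only [Sum.inr.injEq, Prod.mk.injEq, true_and, Subtype.ext_iff] using hform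

/-- The isometry `ι` between the parameter intervals of the edge `k` of two curves carries the ends
of the edge, with the vertices to which they are glued, to each other: either it preserves the
direction of the edge, or it reverses it. -/
def RespectsEnds (C C' : TropicalCurve g) (k : Fin (3 * g - 3))
    (ι : Set.Icc (0 : ℝ) (C.len k) ≃ᵢ Set.Icc (0 : ℝ) (C'.len k)) : Prop :=
  (ι (C.start k) = C'.start k ∧ ι (C.finish k) = C'.finish k ∧
    C'.src k = C.src k ∧ C'.tgt k = C.tgt k) ∨
  (ι (C.start k) = C'.finish k ∧ ι (C.finish k) = C'.start k ∧
    C'.src k = C.tgt k ∧ C'.tgt k = C.src k)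

namespace RespectsEnds

variable {k : Fin (3 * g - 3)} {ι : Set.Icc (0 : ℝ) (C.len k) ≃ᵢ Set.Icc (0 : ℝ) (C'.len k)}

theorem symm (h : RespectsEnds C C' k ι) : RespectsEnds C' C k ι.symm := by
  simp only [RespectsEnds, ι.symm_apply_eq]
  rcases h with ⟨hs, hf, hsrc, htgt⟩ | ⟨hs, hf, hsrc, htgt⟩
  · exact Or.inl ⟨hs.symm, hf.symm, hsrc.symm, htgt.symm⟩
  · exact Or.inr ⟨hf.symm, hs.symm, htgt.symm, hsrc.symm⟩

theorem edgePoint_start (h : RespectsEnds C C' k ι) :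
    C'.edgePoint k (ι (C.start k)) = C'.vertex (C.src k) := by
  rcases h with ⟨hs, -, hsrc, -⟩ | ⟨hs, -, -, htgt⟩
  · rw [hs, C'.edgePoint_start, hsrc]
  · rw [hs, C'.edgePoint_finish, htgt]

theorem edgePoint_finish (h : RespectsEnds C C' k ι) :
    C'.edgePoint k (ι (C.finish k)) = C'.vertex (C.tgt k) := by
  rcases h with ⟨-, hf, -, htgt⟩ | ⟨-, hf, hsrc, -⟩
  · rw [hf, C'.edgePoint_finish, htgt]
  · rw [hf, C'.edgePoint_start, hsrc]

theorem of_edgePoint_eq_vertex (hs : C'.edgePoint k (ι (C.start k)) = C'.vertex (C.src k))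
    (hf : C'.edgePoint k (ι (C.finish k)) = C'.vertex (C.tgt k)) : RespectsEnds C C' k ι := by
  have hne : ι (C.start k) ≠ ι (C.finish k) := ι.injective.ne (C.start_ne_finish k)
  rcases edgePoint_eq_vertex hs with ⟨hs, hs'⟩ | ⟨hs, hs'⟩ <;>
    rcases edgePoint_eq_vertex hf with ⟨hf, hf'⟩ | ⟨hf, hf'⟩
  · exact absurd (hs.trans hf.symm) hne
  · exact Or.inl ⟨hs, hf, hs', hf'⟩
  · exact Or.inr ⟨hs, hf, hf', hs'⟩
  · exact absurd (hs.trans hf.symm) hne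

end RespectsEnds

/-- The map of curves that is given by maps of the edges. -/
def pointMap (ι : ∀ k, Set.Icc (0 : ℝ) (C.len k) ≃ᵢ Set.Icc (0 : ℝ) (C'.len k))
    (h : ∀ k, RespectsEnds C C' k (ι k)) : C.Point → C'.Point :=
  Quot.lift (Sum.elim C'.vertex fun x => C'.edgePoint x.1 (ι x.1 x.2)) <| by
    rintro _ _ (k | k)
    · exact (h k).edgePoint_start
    · exact (h k).edgePoint_finish

theorem continuous_pointMap (ι : ∀ k, Set.Icc (0 : ℝ) (C.len k) ≃ᵢ Set.Icc (0 : ℝ) (C'.len k))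
    (h : ∀ k, RespectsEnds C C' k (ι k)) : Continuous (pointMap ι h) :=
  C.continuous_of_continuous_edgePoint fun k => (C'.continuous_edgePoint k).comp (ι k).continuous

/-- The homeomorphism of curves that is given by maps of the edges. -/
def pointHomeomorph (ι : ∀ k, Set.Icc (0 : ℝ) (C.len k) ≃ᵢ Set.Icc (0 : ℝ) (C'.len k))
    (h : ∀ k, RespectsEnds C C' k (ι k)) : C.Point ≃ₜ C'.Point where
  toFun := pointMap ι h
  invFun := pointMap (fun k => (ι k).symm) fun k => (h k).symm
  left_inv := by
    rintro ⟨v | ⟨k, t⟩⟩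
    · rfl
    · exact congrArg (C.edgePoint k) ((ι k).symm_apply_apply t)
  right_inv := by
    rintro ⟨v | ⟨k, t⟩⟩
    · rfl
    · exact congrArg (C'.edgePoint k) ((ι k).apply_symm_apply t)
  continuous_toFun := continuous_pointMap ι h
  continuous_invFun := continuous_pointMap _ fun k => (h k).symm

end TropicalCurve

section Interval

variable {a b : ℝ}

/-- The identification of intervals of equal length. -/
def iccCongr (h : a = b) : Set.Icc (0 : ℝ) a ≃ᵢ Set.Icc (0 : ℝ) b where
  toFun t := ⟨t, t.2.1, t.2.2.trans_eq h⟩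
  invFun t := ⟨t, t.2.1, t.2.2.trans_eq h.symm⟩
  isometry_toFun := Isometry.of_dist_eq fun _ _ => rfl

/-- The identification of intervals of equal length that reverses the direction. -/
def iccReverse (h : a = b) : Set.Icc (0 : ℝ) a ≃ᵢ Set.Icc (0 : ℝ) b where
  toFun t := ⟨b - t, by linarith [t.2.2], by linarith [t.2.1]⟩
  invFun t := ⟨a - t, by linarith [t.2.2], by linarith [t.2.1]⟩
  left_inv t := Subtype.ext (by simp [h])
  right_inv t := Subtype.ext (by simp [h])
  isometry_toFun := Isometry.of_dist_eq fun t u => by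
    rw [Subtype.dist_eq, Subtype.dist_eq, dist_sub_left]

theorem coe_iccReverse (h : a = b) (t : Set.Icc (0 : ℝ) a) : (iccReverse h t : ℝ) = b - t := rfl

theorem coe_isometryEquiv_apply {ι : Set.Icc (0 : ℝ) a ≃ᵢ Set.Icc (0 : ℝ) b}
    {x : Set.Icc (0 : ℝ) a} (hx : (x : ℝ) = 0) (hι : (ι x : ℝ) = 0) (t : Set.Icc (0 : ℝ) a) :
    (ι t : ℝ) = t := by
  have hdist := ι.dist_eq t x
  rwa [Subtype.dist_eq, Subtype.dist_eq, Real.dist_eq, Real.dist_eq, hx, hι, sub_zero, sub_zero,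
    abs_of_nonneg t.2.1, abs_of_nonneg (ι t).2.1] at hdist

end Interval

section Circle

variable {L : ℝ}

theorem addCircle_coe_eq_coe_iff (a b : ℝ) :
    (a : AddCircle L) = b ↔ ∃ j : ℤ, a = b + j * L := by
  rw [← sub_eq_zero, ← AddCircle.coe_sub, AddCircle.coe_eq_zero_iff]
  simp only [zsmul_eq_mul, sub_eq_iff_eq_add', eq_comm]

theorem eq_of_addCircle_coe_mul_eq (hL : 0 < L) {a b ℓ : ℝ} (hℓ : 0 < ℓ)
    (h : ∀ t ∈ Set.Icc 0 ℓ, ((a * t : ℝ) : AddCircle L) = ((b * t : ℝ) : AddCircle L)) :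
    a = b := by
  by_contra hne
  have hslope : 0 < |a - b| := abs_pos.2 (sub_ne_zero.2 hne)
  -- A time so small that the circle still looks like the line.
  obtain ⟨t, ht0, htℓ, hsmall⟩ : ∃ t, 0 < t ∧ t ≤ ℓ ∧ |a - b| * t ≤ L / 2 :=
    ⟨min ℓ (L / 2 / |a - b|), by positivity, min_le_left _ _,
      (le_div_iff₀' hslope).1 (min_le_right _ _)⟩
  have habs : |(a - b) * t| = |a - b| * t := by rw [abs_mul, abs_of_pos ht0]
  have hnorm := (AddCircle.norm_coe_eq_abs_iff L hL.ne').2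
    (by rwa [habs, abs_of_pos hL] : |(a - b) * t| ≤ |L| / 2)
  rw [sub_mul, AddCircle.coe_sub, h t ⟨ht0.le, htℓ⟩, sub_self, norm_zero, ← sub_mul, habs] at hnorm
  exact (mul_pos hslope ht0).ne hnorm

end Circle

/-! ### Isomorphisms and fibers of covers -/

theorem ncard_int_mem_uIcc {α β : ℝ} (hα : ∀ j : ℤ, (j : ℝ) ≠ α) (hβ : ∀ j : ℤ, (j : ℝ) ≠ β) :
    {j : ℤ | (j : ℝ) ∈ Set.uIcc α β}.ncard = (⌊β⌋ - ⌊α⌋).natAbs := by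
  wlog hle : α ≤ β generalizing α β
  · rw [Set.uIcc_comm, this hβ hα (le_of_not_ge hle), ← Int.natAbs_neg, neg_sub]
  have hIoc : {j : ℤ | (j : ℝ) ∈ Set.uIcc α β} = (Finset.Ioc ⌊α⌋ ⌊β⌋ : Set ℤ) := by
    ext j
    rw [Finset.coe_Ioc, Set.mem_Ioc, Int.floor_lt, Int.le_floor, Set.mem_ofPred_eq,
      Set.uIcc_of_le hle, Set.mem_Icc, (hα j).symm.le_iff_lt]
  have hfloor := Int.floor_mono hle
  rw [hIoc, Set.ncard_coe_finset, Int.card_Ioc]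
  omega

theorem ncard_affine_eq_int {a b ℓ : ℝ} (ha : a ≠ 0) (hℓ : 0 ≤ ℓ) (h0 : ∀ j : ℤ, (j : ℝ) ≠ b)
    (h1 : ∀ j : ℤ, (j : ℝ) ≠ a * ℓ + b) :
    {t : Set.Icc 0 ℓ | ∃ j : ℤ, (j : ℝ) = a * t + b}.ncard = (⌊a * ℓ + b⌋ - ⌊b⌋).natAbs := by
  have hinj : Function.Injective fun t : Set.Icc 0 ℓ => a * (t : ℝ) + b := fun t u h =>
    Subtype.ext (mul_left_cancel₀ ha (add_right_cancel h))
  have hinterval : (fun t => a * t + b) '' Set.Icc 0 ℓ = Set.uIcc b (a * ℓ + b) := by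
    rw [← Set.uIcc_of_le hℓ, ← Set.image_image (· + b) (a * ·), Set.image_const_mul_uIcc,
      Set.image_add_const_uIcc, mul_zero, zero_add]
  have himage : (fun t : Set.Icc 0 ℓ => a * (t : ℝ) + b) ''
      {t | ∃ j : ℤ, (j : ℝ) = a * t + b}
        = Int.cast '' {j : ℤ | (j : ℝ) ∈ Set.uIcc b (a * ℓ + b)} := by
    rw [← hinterval]
    ext r
    constructor
    · rintro ⟨t, ⟨j, hj⟩, rfl⟩
      exact ⟨j, ⟨t, t.2, hj.symm⟩, hj⟩
    · rintro ⟨j, ⟨t, ht, hj⟩, rfl⟩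
      exact ⟨⟨t, ht⟩, ⟨j, hj.symm⟩, hj⟩
  rw [← ncard_int_mem_uIcc h0 h1, ← Set.ncard_image_of_injective _ hinj, himage,
    Set.ncard_image_of_injective _ Int.cast_injective]

namespace LabeledCover

open TropicalCurve

variable {g : ℕ} {L : ℝ}

theorem map_edgePoint (c : LabeledCover g L) (k : Fin (3 * g - 3))
    (t : Set.Icc (0 : ℝ) (c.curve.len k)) :
    c.map (c.curve.edgePoint k t) = c.map (c.curve.vertex (c.curve.src k))
      + (((c.slope k : ℝ) * (t : ℝ) : ℝ) : AddCircle L) := by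
  rw [c.affine, edgePoint_start]

theorem map_tgt (c : LabeledCover g L) (k : Fin (3 * g - 3)) :
    c.map (c.curve.vertex (c.curve.tgt k)) = c.map (c.curve.vertex (c.curve.src k))
      + (((c.slope k : ℝ) * c.curve.len k : ℝ) : AddCircle L) := by
  rw [← edgePoint_finish, map_edgePoint]
  rfl

section Iso

variable {c c' : LabeledCover g L}

theorem iso_of_respectsEnds (hv : ∀ v, c'.map (c'.curve.vertex v) = c.map (c.curve.vertex v))
    (he : ∀ k, ∃ ι, RespectsEnds c.curve c'.curve k ι ∧
      ∀ t, c'.map (c'.curve.edgePoint k (ι t)) = c.map (c.curve.edgePoint k t)) : Iso c c' := by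
  choose ι hends hmap using he
  refine ⟨pointHomeomorph ι hends, fun _ => rfl, fun k => ⟨ι k, fun _ => rfl⟩, ?_⟩
  rintro ⟨v | ⟨k, t⟩⟩
  · exact hv v
  · exact hmap k t

theorem iso_of_eq_or_reverse (hlen : ∀ k, c.curve.len k = c'.curve.len k)
    (hv : ∀ v, c'.map (c'.curve.vertex v) = c.map (c.curve.vertex v))
    (he : ∀ k, (c.curve.src k = c'.curve.src k ∧ c.curve.tgt k = c'.curve.tgt k
        ∧ c.slope k = c'.slope k) ∨
      (c.curve.src k = c'.curve.tgt k ∧ c.curve.tgt k = c'.curve.src k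
        ∧ c.slope k = -c'.slope k)) : Iso c c' := by
  refine iso_of_respectsEnds hv fun k => ?_
  rcases he k with ⟨hsrc, htgt, hslope⟩ | ⟨hsrc, htgt, hslope⟩
  · refine ⟨iccCongr (hlen k), Or.inl ⟨rfl, Subtype.ext (hlen k), hsrc.symm, htgt.symm⟩,
      fun t => ?_⟩
    rw [map_edgePoint, map_edgePoint, hsrc, hslope, hv]
    rfl
  · refine ⟨iccReverse (hlen k), Or.inr ⟨Subtype.ext (sub_zero _),
      Subtype.ext (sub_eq_zero.2 (hlen k).symm), htgt.symm, hsrc.symm⟩, fun t => ?_⟩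
    rw [map_edgePoint, map_edgePoint, hsrc, hslope, ← hv, map_tgt, add_assoc, ← AddCircle.coe_add,
      coe_iccReverse]
    congr 3
    push_cast
    ring

theorem respectsEnds_of_iso {φ : c.curve.Point ≃ₜ c'.curve.Point}
    (hv : ∀ v, φ (c.curve.vertex v) = c'.curve.vertex v) {k : Fin (3 * g - 3)}
    {ι : Set.Icc (0 : ℝ) (c.curve.len k) ≃ᵢ Set.Icc (0 : ℝ) (c'.curve.len k)}
    (hι : ∀ t, φ (c.curve.edgePoint k t) = c'.curve.edgePoint k (ι t)) :
    RespectsEnds c.curve c'.curve k ι :=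
  .of_edgePoint_eq_vertex (by rw [← hι, edgePoint_start, hv]) (by rw [← hι, edgePoint_finish, hv])

theorem combType_eq_of_iso (h : Iso c c') : c.curve.combType = c'.curve.combType := by
  obtain ⟨φ, hv, he, -⟩ := h
  funext k
  obtain ⟨ι, hι⟩ := he k
  unfold combType
  rcases respectsEnds_of_iso hv hι with ⟨-, -, hsrc, htgt⟩ | ⟨-, -, hsrc, htgt⟩
  · rw [hsrc, htgt]
  · rw [hsrc, htgt, Sym2.eq_swap]

theorem ncard_fiber_eq_of_iso (h : Iso c c') (k : Fin (3 * g - 3)) (x : AddCircle L) :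
    (c.fiber k x).ncard = (c'.fiber k x).ncard := by
  obtain ⟨φ, -, he, hm⟩ := h
  obtain ⟨ι, hι⟩ := he k
  have himage : φ '' c.fiber k x = c'.fiber k x := by
    ext P
    constructor
    · rintro ⟨_, ⟨hx, t, rfl⟩, rfl⟩
      exact ⟨(hm _).trans hx, ι t, (hι t).symm⟩
    · rintro ⟨hx, t, rfl⟩
      have ht : φ (c.curve.edgePoint k (ι.symm t)) = c'.curve.edgePoint k t := by
        rw [hι, ι.apply_symm_apply]
      exact ⟨_, ⟨by rw [← hm, ht, hx], ι.symm t, rfl⟩, ht⟩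
  rw [← himage, Set.ncard_image_of_injective _ φ.injective]

theorem len_eq_and_slope_eq_of_iso [hL : Fact (0 < L)] (h : Iso c c') {k : Fin (3 * g - 3)}
    (hsrc : c.curve.src k = c'.curve.src k) (hne : c.curve.src k ≠ c.curve.tgt k) :
    c.curve.len k = c'.curve.len k ∧ c.slope k = c'.slope k := by
  obtain ⟨φ, hv, he, hm⟩ := h
  obtain ⟨ι, hι⟩ := he k
  rcases respectsEnds_of_iso hv hι with ⟨hstart, hfinish, -, -⟩ | ⟨-, -, hsrc', -⟩
  · have hval : ∀ t, (ι t : ℝ) = t :=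
      coe_isometryEquiv_apply (x := c.curve.start k) rfl (congrArg Subtype.val hstart)
    refine ⟨(hval _).symm.trans (congrArg Subtype.val hfinish), ?_⟩
    have hslope : (c.slope k : ℝ) = c'.slope k :=
      eq_of_addCircle_coe_mul_eq hL.out (c.curve.len_pos k) fun t ht => by
        have hmap := hm (c.curve.edgePoint k ⟨t, ht⟩)
        rw [hι, map_edgePoint, map_edgePoint, hval, ← hsrc, ← hv, hm, add_right_inj] at hmap
        exact hmap.symm
    exact_mod_cast hslope
  · exact absurd (hsrc.trans hsrc') hne

end Iso

section Fiber

variable (c : LabeledCover g L) {k : Fin (3 * g - 3)} {x ξ : ℝ}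

theorem map_edgePoint_eq_coe_iff [hL : Fact (0 < L)]
    (hx : c.map (c.curve.vertex (c.curve.src k)) = (x : AddCircle L))
    {t : Set.Icc (0 : ℝ) (c.curve.len k)} :
    c.map (c.curve.edgePoint k t) = (ξ : AddCircle L) ↔
      ∃ j : ℤ, (j : ℝ) = (x + c.slope k * t - ξ) / L := by
  rw [map_edgePoint, hx, ← AddCircle.coe_add, addCircle_coe_eq_coe_iff]
  refine exists_congr fun j => ?_
  rw [eq_div_iff hL.out.ne', eq_sub_iff_add_eq', eq_comm]

theorem ncard_fiber [hL : Fact (0 < L)]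
    (hx : c.map (c.curve.vertex (c.curve.src k)) = (x : AddCircle L)) (hslope : c.slope k ≠ 0)
    (hsrc : c.map (c.curve.vertex (c.curve.src k)) ≠ (ξ : AddCircle L))
    (htgt : c.map (c.curve.vertex (c.curve.tgt k)) ≠ (ξ : AddCircle L)) :
    (c.fiber k (ξ : AddCircle L)).ncard
      = (⌊(x + c.slope k * c.curve.len k - ξ) / L⌋ - ⌊(x - ξ) / L⌋).natAbs := by
  have haffine : ∀ t : ℝ,
      (x + c.slope k * t - ξ) / L = c.slope k / L * t + (x - ξ) / L := fun t => by ring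
  have hmem : ∀ t, c.map (c.curve.edgePoint k t) = (ξ : AddCircle L) ↔
      ∃ j : ℤ, (j : ℝ) = c.slope k / L * t + (x - ξ) / L := fun t => by
    rw [c.map_edgePoint_eq_coe_iff hx, haffine]
  have hfiber : c.fiber k (ξ : AddCircle L)
      = c.curve.edgePoint k '' {t | ∃ j : ℤ, (j : ℝ) = c.slope k / L * t + (x - ξ) / L} := by
    ext P
    constructor
    · rintro ⟨hP, t, rfl⟩
      exact ⟨t, (hmem t).1 hP, rfl⟩
    · rintro ⟨t, ht, rfl⟩
      exact ⟨(hmem t).2 ht, t, rfl⟩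
  have hinj : Set.InjOn (c.curve.edgePoint k)
      {t | ∃ j : ℤ, (j : ℝ) = c.slope k / L * t + (x - ξ) / L} := fun t ht u _ htu => by
    rw [Set.mem_ofPred_eq, ← hmem] at ht
    refine eq_of_edgePoint_eq ?_ ?_ htu <;> rintro rfl
    · exact hsrc (by rwa [edgePoint_start] at ht)
    · exact htgt (by rwa [edgePoint_finish] at ht)
  rw [hfiber, hinj.ncard_image, haffine]
  refine ncard_affine_eq_int (div_ne_zero (Int.cast_ne_zero.2 hslope) hL.out.ne')
    (c.curve.len_pos k).le (fun j hj => hsrc ?_) fun j hj => htgt ?_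
  · rw [← edgePoint_start, hmem]
    exact ⟨j, by simpa only [start, mul_zero, zero_add] using hj⟩
  · rw [← edgePoint_finish, hmem]
    exact ⟨j, hj⟩

theorem ncard_fiber_mul_weight [hL : Fact (0 < L)]
    (hx : c.map (c.curve.vertex (c.curve.src k)) = (x : AddCircle L)) (hslope : c.slope k ≠ 0)
    (hsrc : c.map (c.curve.vertex (c.curve.src k)) ≠ (ξ : AddCircle L))
    (htgt : c.map (c.curve.vertex (c.curve.tgt k)) ≠ (ξ : AddCircle L)) :
    (((c.fiber k (ξ : AddCircle L)).ncard * c.weight k : ℕ) : ℤ)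
      = c.slope k * (⌊(x + c.slope k * c.curve.len k - ξ) / L⌋ - ⌊(x - ξ) / L⌋) := by
  have hlen := (c.curve.len_pos k).le
  have hL0 := hL.out.le
  rw [c.ncard_fiber hx hslope hsrc htgt, weight, ← Int.natAbs_mul, mul_comm, Int.natCast_natAbs]
  refine abs_of_nonneg ?_
  rcases le_total 0 (c.slope k) with hs | hs
  · have hs' : (0 : ℝ) ≤ c.slope k := Int.cast_nonneg hs
    refine mul_nonneg hs (sub_nonneg.2 (Int.floor_mono ?_))
    gcongr
    exact le_add_of_nonneg_right (mul_nonneg hs' hlen)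
  · have hs' : (c.slope k : ℝ) ≤ 0 := Int.cast_nonpos.2 hs
    refine mul_nonneg_of_nonpos_of_nonpos hs (sub_nonpos.2 (Int.floor_mono ?_))
    gcongr
    exact add_le_of_nonpos_right (mul_nonpos_of_nonpos_of_nonneg hs' hlen)

end Fiber

end LabeledCover

/-! ### Balancing -/

theorem sum_pos_natAbs_eq_sum_neg_natAbs_iff {ι : Type*} (s : Finset ι) (f : ι → ℤ) :
    ∑ i ∈ s with 0 < f i, (f i).natAbs = ∑ i ∈ s with f i < 0, (f i).natAbs ↔
      ∑ i ∈ s, f i = 0 := by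
  have hdiff : ∑ i ∈ s, f i = ((∑ i ∈ s with 0 < f i, (f i).natAbs : ℕ) : ℤ)
      - (∑ i ∈ s with f i < 0, (f i).natAbs : ℕ) := by
    rw [Finset.sum_filter, Finset.sum_filter, Nat.cast_sum, Nat.cast_sum, ← Finset.sum_sub_distrib]
    refine Finset.sum_congr rfl fun i _ => ?_
    split_ifs <;> omega
  rw [hdiff, sub_eq_zero, Nat.cast_inj]

namespace TropicalCurve

variable {g : ℕ} (C : TropicalCurve g)

theorem card_rays (v : Fin (2 * g - 2)) :
    (Finset.univ.filter fun r => C.rayVertex r = v).card = C.combType.valence v := by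
  rw [Finset.card_filter, Fintype.sum_prod_type]
  refine Finset.sum_congr rfl fun k _ => ?_
  change _ = Multiset.count v {C.src k, C.tgt k}
  simp only [Fintype.sum_bool, rayVertex, if_true, Bool.false_eq_true, if_false,
    Multiset.insert_eq_cons, Multiset.count_cons, Multiset.count_singleton, eq_comm (a := v)]

theorem sum_raySlope (s : Fin (3 * g - 3) → ℤ) (v : Fin (2 * g - 2)) :
    ∑ r with C.rayVertex r = v, raySlope s r = -netFlow C.src C.tgt s v := by
  rw [Finset.sum_filter, Fintype.sum_prod_type, netFlow, ← Finset.sum_neg_distrib]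
  refine Finset.sum_congr rfl fun k _ => ?_
  simp only [Fintype.sum_bool, rayVertex, raySlope, if_true, Bool.false_eq_true, if_false]
  split_ifs <;> ring

theorem raySlope_eq_zero_iff {m : ℕ} {s : Fin m → ℤ} {r : Fin m × Bool} :
    raySlope s r = 0 ↔ s r.1 = 0 := by
  unfold raySlope
  split_ifs <;> simp

theorem sum_pos_raySlope_eq_sum_neg_raySlope_iff (s : Fin (3 * g - 3) → ℤ)
    (v : Fin (2 * g - 2)) :
    (∑ r with C.rayVertex r = v ∧ 0 < raySlope s r, (raySlope s r).natAbs
      = ∑ r with C.rayVertex r = v ∧ raySlope s r < 0, (raySlope s r).natAbs) ↔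
    netFlow C.src C.tgt s v = 0 := by
  rw [← Finset.filter_filter, ← Finset.filter_filter, sum_pos_natAbs_eq_sum_neg_natAbs_iff,
    sum_raySlope, neg_eq_zero]

end TropicalCurve

namespace LabeledCover

open TropicalCurve

variable {g : ℕ} {L : ℝ}

theorem isBalanced_slope (c : LabeledCover g L) : IsBalanced c.curve.src c.curve.tgt c.slope :=
  fun v => (c.curve.sum_pos_raySlope_eq_sum_neg_raySlope_iff c.slope v).1 (c.balanced v)

theorem map_src_eq_map_tgt (c : LabeledCover g L) {k : Fin (3 * g - 3)} (hk : c.slope k = 0) :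
    c.map (c.curve.vertex (c.curve.src k)) = c.map (c.curve.vertex (c.curve.tgt k)) := by
  rw [c.map_tgt, hk, Int.cast_zero, zero_mul, AddCircle.coe_zero, add_zero]

/-- The two rays of a loop have opposite slopes, so by balancing the third edge at its vertex has
slope zero. Its ends have the same image, hence it is a loop as well: there is no room for that. -/
theorem loopless_of_injective {c : LabeledCover g L}
    (hc : Function.Injective fun v => c.map (c.curve.vertex v)) :
    LabeledGraph.Loopless c.curve.combType := by
  intro k hk
  have hloop : c.curve.src k = c.curve.tgt k := hk
  let rays : Finset (Fin (3 * g - 3) × Bool) :=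
    Finset.univ.filter fun r => c.curve.rayVertex r = c.curve.tgt k
  have hmem : ∀ r, r ∈ rays ↔ c.curve.rayVertex r = c.curve.tgt k := fun r => by simp [rays]
  have hpair : {(k, true), (k, false)} ⊆ rays := by
    simp [Finset.insert_subset_iff, hmem, rayVertex, hloop]
  obtain ⟨r, hr⟩ : ∃ r, rays \ {(k, true), (k, false)} = {r} := by
    have hvalence : c.curve.combType.valence (c.curve.tgt k) = 3 := c.curve.isFeynman.trivalent _
    rw [← Finset.card_eq_one, Finset.card_sdiff_of_subset hpair, c.curve.card_rays, hvalence,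
      Finset.card_pair (by simp)]
  have hslope : raySlope c.slope r = 0 := by
    have hsum := Finset.sum_sdiff (f := raySlope c.slope) hpair
    rw [hr, c.curve.sum_raySlope, c.isBalanced_slope, Finset.sum_singleton,
      Finset.sum_pair (by simp)] at hsum
    simpa [raySlope] using hsum
  have hr_loop : c.curve.src r.1 = c.curve.tgt r.1 :=
    hc (c.map_src_eq_map_tgt (raySlope_eq_zero_iff.1 hslope))
  have hr_mem : r ∈ rays \ {(k, true), (k, false)} := hr ▸ Finset.mem_singleton_self r
  have hopposite : (r.1, !r.2) ∈ rays \ {(k, true), (k, false)} := by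
    rw [Finset.mem_sdiff, hmem] at hr_mem ⊢
    clear hr hslope
    obtain ⟨j, side⟩ := r
    cases side <;> simp_all [rayVertex]
  rw [hr, Finset.mem_singleton] at hopposite
  exact Bool.not_ne_self r.2 (congrArg Prod.snd hopposite)

end LabeledCover

/-! ### Orientations by a vertex order -/

namespace LabeledGraph

variable {g : ℕ}

/-- The end of the edge `k` that comes first in the order `Ω`. -/
def lowEnd (Γ : LabeledGraph g) (Ω : Equiv.Perm (Fin (2 * g - 2))) (k : Fin (3 * g - 3)) :
    Fin (2 * g - 2) :=
  Ω.symm ((Γ k).map Ω).inf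

/-- The end of the edge `k` that comes last in the order `Ω`. -/
def highEnd (Γ : LabeledGraph g) (Ω : Equiv.Perm (Fin (2 * g - 2))) (k : Fin (3 * g - 3)) :
    Fin (2 * g - 2) :=
  Ω.symm ((Γ k).map Ω).sup

theorem mk_lowEnd_highEnd (Γ : LabeledGraph g) (Ω : Equiv.Perm (Fin (2 * g - 2)))
    (k : Fin (3 * g - 3)) : s(Γ.lowEnd Ω k, Γ.highEnd Ω k) = Γ k := by
  unfold lowEnd highEnd
  induction Γ k with | _ u v
  rcases le_total (Ω u) (Ω v) with h | h <;> simp [h]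

theorem lowEnd_lt_highEnd {Γ : LabeledGraph g} (hΓ : Γ.Loopless)
    (Ω : Equiv.Perm (Fin (2 * g - 2))) (k : Fin (3 * g - 3)) :
    Ω (Γ.lowEnd Ω k) < Ω (Γ.highEnd Ω k) := by
  refine lt_of_le_of_ne ?_ fun h => hΓ k ?_
  · simpa [lowEnd, highEnd] using Sym2.inf_le_sup _
  · rw [← Γ.mk_lowEnd_highEnd Ω k, Sym2.mk_isDiag_iff]
    exact Ω.injective h

theorem one_lt_of_isFeynman {Γ : LabeledGraph g} (hΓ : Γ.IsFeynman) : 1 < g := by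
  obtain ⟨v⟩ := hΓ.connected.nonempty
  have := v.2
  omega

end LabeledGraph

/-! ### Covers from flows -/

namespace Strand

variable {L D ℓ : ℝ}

theorem slope_mul_pos (h0 : 0 < D) (hD : D < L) (d : Strand) : 0 < d.slope * (D + d.1 * L) := by
  have hδ : 0 < min D (L - D) := lt_min h0 (sub_pos.2 hD)
  refine lt_of_lt_of_le ?_ (d.le_slope_mul hδ.le (min_le_left _ _) (min_le_right _ _))
  have hw : (0 : ℝ) < (d.2 : ℕ) := by exact_mod_cast d.2.pos
  exact mul_pos (half_pos hδ) (add_pos_of_nonneg_of_pos (Nat.cast_nonneg _) hw)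

/-- The length of an edge that carries the strand `d` on a circle of circumference `L`, if the lifts
of its ends to a fundamental domain differ by `D`. -/
noncomputable def length (L D : ℝ) (d : Strand) : ℝ := (D + d.1 * L) / d.slope

theorem slope_mul_length (d : Strand) : d.slope * d.length L D = D + d.1 * L :=
  mul_div_cancel₀ _ (Int.cast_ne_zero.2 d.slope_ne_zero)

theorem length_pos (h0 : 0 < D) (hD : D < L) (d : Strand) : 0 < d.length L D := by
  have hsq : (d.slope : ℝ) * (d.slope * d.length L D) = d.slope ^ 2 * d.length L D := by ring
  have hpos := slope_mul_pos h0 hD d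
  rw [← slope_mul_length, hsq] at hpos
  exact pos_of_mul_pos_right hpos (sq_nonneg _)

theorem exists_slope_eq_and_length_eq {s n : ℤ} (h0 : 0 < D) (hD : D < L) (hℓ : 0 < ℓ)
    (h : s * ℓ = D + n * L) : ∃ d : Strand, d.slope = s ∧ d.length L D = ℓ := by
  have hs : s ≠ 0 := by
    rintro rfl
    have hpos := slope_mul_pos h0 hD (n, 1)
    rw [← h] at hpos
    simp at hpos
  let d : Strand := (n, ⟨s.natAbs, Int.natAbs_pos.2 hs⟩)
  have hslope : d.slope = s := by
    refine (Int.natAbs_eq_natAbs_iff.1 d.natAbs_slope).resolve_right fun hneg => ?_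
    have hpos : 0 < (d.slope : ℝ) * (s * ℓ) := h ▸ slope_mul_pos h0 hD d
    rw [hneg, Int.cast_neg] at hpos
    nlinarith [mul_nonneg (sq_nonneg (s : ℝ)) hℓ.le]
  refine ⟨d, hslope, ?_⟩
  rw [length, hslope, ← h, mul_div_cancel_left₀ _ (Int.cast_ne_zero.2 hs)]

end Strand

/-- The lifts `X i` of the points `p i`, in increasing order, to the fundamental domain that starts
at the lift `b` of the base point. -/
structure IsSortedLift {N : ℕ} {L : ℝ} (p₀ : AddCircle L) (p : Fin N → AddCircle L) (b : ℝ)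
    (X : Fin N → ℝ) : Prop where
  strictMono : StrictMono X
  mem : ∀ i, X i ∈ Set.Ioo b (b + L)
  base : (b : AddCircle L) = p₀
  range : Set.range (fun i => (X i : AddCircle L)) = Set.range p

namespace IsSortedLift

variable {N : ℕ} {L : ℝ} {p₀ : AddCircle L} {p : Fin N → AddCircle L} {b : ℝ} {X : Fin N → ℝ}

theorem sub_pos (h : IsSortedLift p₀ p b X) {i j : Fin N} (hij : i < j) : 0 < X j - X i :=
  _root_.sub_pos.2 (h.strictMono hij)

theorem sub_lt (h : IsSortedLift p₀ p b X) (i j : Fin N) : X j - X i < L := by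
  linarith [(h.mem j).2, (h.mem i).1]

variable [hL : Fact (0 < L)]

theorem exists_of_injective (hp : Function.Injective p) (hp₀ : p₀ ∉ Set.range p) :
    ∃ b X, IsSortedLift p₀ p b X := by
  obtain ⟨b, rfl⟩ := QuotientAddGroup.mk_surjective p₀
  let Y : Fin N → ℝ := fun i => AddCircle.equivIco L b (p i)
  have hY : ∀ i, (Y i : AddCircle L) = p i := fun i => AddCircle.coe_equivIco
  have hinj : Function.Injective Y := fun i j h => hp (by rw [← hY i, ← hY j, h])
  have hmem : ∀ i, Y i ∈ Set.Ioo b (b + L) := fun i => by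
    have hIco : Y i ∈ Set.Ico b (b + L) := (AddCircle.equivIco L b (p i)).2
    refine ⟨lt_of_le_of_ne hIco.1 fun h => hp₀ ⟨i, ?_⟩, hIco.2⟩
    rw [← hY i, ← h]
  refine ⟨b, Y ∘ Tuple.sort Y, (Tuple.monotone_sort Y).strictMono_of_injective
    (hinj.comp (Tuple.sort Y).injective), fun i => hmem _, rfl, ?_⟩
  simp only [Function.comp_apply, hY]
  exact (Tuple.sort Y).surjective.range_comp p

theorem coe_ne_coe (h : IsSortedLift p₀ p b X) {i : Fin N} {ξ : ℝ} (hξ : ξ ∈ Set.Ico b (b + L))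
    (hne : X i ≠ ξ) : (X i : AddCircle L) ≠ ξ := fun he =>
  hne ((AddCircle.coe_eq_coe_iff_of_mem_Ico (Set.Ioo_subset_Ico_self (h.mem i)) hξ).1 he)

theorem coe_injective (h : IsSortedLift p₀ p b X) :
    Function.Injective fun i => (X i : AddCircle L) := fun i j hij => by
  by_contra hne
  exact h.coe_ne_coe (Set.Ioo_subset_Ico_self (h.mem j)) (h.strictMono.injective.ne hne) hij

theorem floor_add_sub_div (h : IsSortedLift p₀ p b X) (i : Fin N) {ξ : ℝ}
    (hξ : ξ ∈ Set.Ico b (b + L)) (n : ℤ) :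
    ⌊(X i + n * L - ξ) / L⌋ = n + if X i < ξ then -1 else 0 := by
  have hL0 : 0 < L := hL.out
  obtain ⟨hX0, hX1⟩ := h.mem i
  obtain ⟨hξ0, hξ1⟩ := hξ
  rw [Int.floor_eq_iff, le_div_iff₀ hL0, div_lt_iff₀ hL0]
  split_ifs <;> push_cast <;> constructor <;> linarith

end IsSortedLift

section CoverOfFlow

open LabeledGraph

variable {g : ℕ} {L : ℝ} {p₀ : AddCircle L} {p : Fin (2 * g - 2) → AddCircle L} {b : ℝ}
  {X : Fin (2 * g - 2) → ℝ} {Γ : LabeledGraph g}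

/-- The metric graph with underlying graph `Γ` whose edges carry the strands `f`, when the vertex
`x_v` lies over the point `X (Ω v)`. -/
noncomputable def flowCurve (h : IsSortedLift p₀ p b X) (hΓ : IsFeynman Γ) (hl : Loopless Γ)
    (Ω : Equiv.Perm (Fin (2 * g - 2))) (f : Fin (3 * g - 3) → Strand) : TropicalCurve g where
  src := Γ.lowEnd Ω
  tgt := Γ.highEnd Ω
  len k := (f k).length L (X (Ω (Γ.highEnd Ω k)) - X (Ω (Γ.lowEnd Ω k)))
  len_pos k := (f k).length_pos (h.sub_pos (lowEnd_lt_highEnd hl Ω k)) (h.sub_lt _ _)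
  isFeynman := by
    rw [funext (Γ.mk_lowEnd_highEnd Ω)]
    exact hΓ

/-- The map from `flowCurve` to the elliptic curve that sends the vertex `x_v` to `X (Ω v)` and has
the slope of the strand `f k` on the edge `q_k`. -/
noncomputable def flowMap (h : IsSortedLift p₀ p b X) (hΓ : IsFeynman Γ) (hl : Loopless Γ)
    (Ω : Equiv.Perm (Fin (2 * g - 2))) (f : Fin (3 * g - 3) → Strand) :
    (flowCurve h hΓ hl Ω f).Point → AddCircle L :=
  Quot.lift (Sum.elim (fun v => (X (Ω v) : AddCircle L)) fun x =>
      ((X (Ω (Γ.lowEnd Ω x.1)) + (f x.1).slope * (x.2 : ℝ) : ℝ) : AddCircle L)) <| by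
    rintro _ _ (k | k)
    · simp [TropicalCurve.start, flowCurve]
    · rw [Sum.elim_inr, Sum.elim_inl, addCircle_coe_eq_coe_iff]
      refine ⟨(f k).1, ?_⟩
      change X (Ω (Γ.lowEnd Ω k)) + (f k).slope * (f k).length L _ = X (Ω (Γ.highEnd Ω k)) + _
      rw [Strand.slope_mul_length]
      ring

variable [hL : Fact (0 < L)]

/-- The labeled cover that is given by an order of the vertices and a flow. -/
noncomputable def flowCover (h : IsSortedLift p₀ p b X) (hΓ : IsFeynman Γ) (hl : Loopless Γ)
    (Ω : Equiv.Perm (Fin (2 * g - 2))) (f : Fin (3 * g - 3) → Strand)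
    (hf : IsBalanced (Γ.lowEnd Ω) (Γ.highEnd Ω) fun k => (f k).slope) : LabeledCover g L where
  curve := flowCurve h hΓ hl Ω f
  map := flowMap h hΓ hl Ω f
  continuous_map := (flowCurve h hΓ hl Ω f).continuous_of_continuous_edgePoint fun k =>
    (AddCircle.continuous_mk' L).comp
      (by fun_prop : Continuous fun t : Set.Icc (0 : ℝ) _ =>
        X (Ω (Γ.lowEnd Ω k)) + (f k).slope * (t : ℝ))
  nonconstant := by
    have hg := one_lt_of_isFeynman hΓ
    refine ⟨(flowCurve h hΓ hl Ω f).vertex ⟨0, by omega⟩,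
      (flowCurve h hΓ hl Ω f).vertex ⟨1, by omega⟩, fun he => ?_⟩
    simpa using Ω.injective (h.coe_injective he)
  slope k := (f k).slope
  affine k t := by
    change ((X (Ω (Γ.lowEnd Ω k)) + (f k).slope * (t : ℝ) : ℝ) : AddCircle L)
      = ((X (Ω (Γ.lowEnd Ω k)) + (f k).slope * (0 : ℝ) : ℝ) : AddCircle L) + _
    rw [mul_zero, add_zero, AddCircle.coe_add]
  balanced v := ((flowCurve h hΓ hl Ω f).sum_pos_raySlope_eq_sum_neg_raySlope_iff _ v).2 (hf v)

section FlowCover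

variable (h : IsSortedLift p₀ p b X) (hΓ : IsFeynman Γ) (hl : Loopless Γ)
  (Ω : Equiv.Perm (Fin (2 * g - 2))) (f : Fin (3 * g - 3) → Strand)
  (hf : IsBalanced (Γ.lowEnd Ω) (Γ.highEnd Ω) fun k => (f k).slope)

theorem flowCover_map_vertex (v : Fin (2 * g - 2)) :
    (flowCover h hΓ hl Ω f hf).map ((flowCover h hΓ hl Ω f hf).curve.vertex v)
      = (X (Ω v) : AddCircle L) := rfl

theorem flowCover_combType : (flowCover h hΓ hl Ω f hf).curve.combType = Γ :=
  funext (Γ.mk_lowEnd_highEnd Ω)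

theorem flowCover_weight (k : Fin (3 * g - 3)) : (flowCover h hΓ hl Ω f hf).weight k = (f k).2 :=
  (f k).natAbs_slope

theorem flowCover_ncard_fiber (k : Fin (3 * g - 3)) {ξ : ℝ} (hξ : ξ ∈ Set.Ico b (b + L))
    (hne : ∀ i, X i ≠ ξ) :
    ((((flowCover h hΓ hl Ω f hf).fiber k (ξ : AddCircle L)).ncard
        * (flowCover h hΓ hl Ω f hf).weight k : ℕ) : ℤ)
      = (f k).degree + (f k).slope * ((if X (Ω (Γ.highEnd Ω k)) < ξ then -1 else 0)
          - (if X (Ω (Γ.lowEnd Ω k)) < ξ then -1 else 0)) := by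
  have hend : X (Ω (Γ.lowEnd Ω k)) + (f k).slope * (flowCurve h hΓ hl Ω f).len k
      = X (Ω (Γ.highEnd Ω k)) + (f k).1 * L := by
    change _ + _ * (f k).length L _ = _
    rw [Strand.slope_mul_length]
    ring
  have hlow := h.floor_add_sub_div (Ω (Γ.lowEnd Ω k)) hξ 0
  rw [Int.cast_zero, zero_mul, add_zero, zero_add] at hlow
  rw [(flowCover h hΓ hl Ω f hf).ncard_fiber_mul_weight (k := k) (x := X (Ω (Γ.lowEnd Ω k)))
    rfl (f k).slope_ne_zero (h.coe_ne_coe hξ (hne _)) (h.coe_ne_coe hξ (hne _))]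
  change (f k).slope * (⌊(_ + (f k).slope * (flowCurve h hΓ hl Ω f).len k - ξ) / L⌋ - _) = _
  rw [hend, hlow, h.floor_add_sub_div _ hξ, ← Strand.slope_mul_winding]
  ring

/-- Compared with the fiber of the base point, the fiber of `ξ` changes by the boundary of the
indicator function of the vertices below `ξ`, which the flow does not see since it is balanced. -/
theorem flowCover_hasDegree : (flowCover h hΓ hl Ω f hf).HasDegree (∑ k, (f k).degree) := by
  intro x hx
  obtain ⟨ξ, hξ, rfl⟩ : ∃ ξ ∈ Set.Ico b (b + L), (ξ : AddCircle L) = x :=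
    ⟨_, (AddCircle.equivIco L b x).2, AddCircle.coe_equivIco⟩
  have hne : ∀ i, X i ≠ ξ := fun i hi => hx (Ω.symm i) (by
    rw [flowCover_map_vertex, Ω.apply_symm_apply, hi])
  have hbalance := sum_netFlow_mul (R := ℤ) (Γ.lowEnd Ω) (Γ.highEnd Ω) (fun k => (f k).slope)
    fun v => if X (Ω v) < ξ then -1 else 0
  simp only [Int.cast_id, hf _, zero_mul, Finset.sum_const_zero] at hbalance
  refine Nat.cast_injective (R := ℤ) ?_
  rw [Nat.cast_sum, Nat.cast_sum,
    Finset.sum_congr rfl fun k _ => flowCover_ncard_fiber h hΓ hl Ω f hf k hξ hne,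
    Finset.sum_add_distrib, ← hbalance, add_zero]

theorem flowCover_branchType (k : Fin (3 * g - 3)) :
    ((flowCover h hΓ hl Ω f hf).fiber k p₀).ncard * (flowCover h hΓ hl Ω f hf).weight k
      = (f k).degree := by
  have hlt : ∀ i, ¬ X i < b := fun i => (h.mem i).1.not_gt
  have hfiber := flowCover_ncard_fiber h hΓ hl Ω f hf k (ξ := b)
    ⟨le_rfl, lt_add_of_pos_right b hL.out⟩ fun i => (h.mem i).1.ne'
  simpa only [h.base, hlt, if_false, sub_self, mul_zero, add_zero, Nat.cast_inj] using hfiber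

theorem flowCover_hasBranchType {a : Fin (3 * g - 3) → ℕ} (ha : ∀ k, (f k).degree = a k) :
    (flowCover h hΓ hl Ω f hf).HasBranchType p₀ p a where
  branchPoints := by
    rw [← h.range]
    exact Ω.surjective.range_comp fun i => (X i : AddCircle L)
  degree := by
    rw [← Finset.sum_congr rfl fun k _ => ha k]
    exact flowCover_hasDegree h hΓ hl Ω f hf
  branchType k := by rw [flowCover_branchType, ha]

end FlowCover

theorem eq_and_eq_of_iso_flowCover (h : IsSortedLift p₀ p b X) (hΓ : IsFeynman Γ)
    (hl : Loopless Γ) {Ω Ω' : Equiv.Perm (Fin (2 * g - 2))} {f f' : Fin (3 * g - 3) → Strand}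
    (hf : IsBalanced (Γ.lowEnd Ω) (Γ.highEnd Ω) fun k => (f k).slope)
    (hf' : IsBalanced (Γ.lowEnd Ω') (Γ.highEnd Ω') fun k => (f' k).slope)
    (hiso : LabeledCover.Iso (flowCover h hΓ hl Ω f hf) (flowCover h hΓ hl Ω' f' hf')) :
    Ω = Ω' ∧ f = f' := by
  obtain rfl : Ω = Ω' := by
    obtain ⟨φ, hv, -, hm⟩ := hiso
    refine Equiv.ext fun v => h.coe_injective ?_
    have hmap := hm ((flowCover h hΓ hl Ω f hf).curve.vertex v)
    rw [hv] at hmap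
    exact hmap.symm
  refine ⟨rfl, funext fun k => ?_⟩
  obtain ⟨hlen, hslope⟩ := LabeledCover.len_eq_and_slope_eq_of_iso hiso (k := k) rfl
    (ne_of_apply_ne Ω (lowEnd_lt_highEnd hl Ω k).ne)
  change (f k).length L _ = (f' k).length L _ at hlen
  change (f k).slope = (f' k).slope at hslope
  have hwinding : ((f k).1 : ℝ) = (f' k).1 := by
    have hlift := congrArg (((f k).slope : ℝ) * ·) hlen
    rw [Strand.slope_mul_length, hslope, Strand.slope_mul_length] at hlift
    exact mul_right_cancel₀ hL.out.ne' (add_left_cancel hlift)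
  refine Prod.ext (Int.cast_injective hwinding) (PNat.eq ?_)
  rw [← Strand.natAbs_slope, hslope, Strand.natAbs_slope]

end CoverOfFlow

section CountOfCovers

open LabeledGraph

variable {g : ℕ} {L : ℝ} {p₀ : AddCircle L} {p : Fin (2 * g - 2) → AddCircle L} {b : ℝ}
  {X : Fin (2 * g - 2) → ℝ} {Γ : LabeledGraph g}

/-! ### Every cover comes from a flow -/

theorem LabeledCover.exists_slope_mul_len_eq (c : LabeledCover g L) {k : Fin (3 * g - 3)} {x y : ℝ}
    (hsrc : c.map (c.curve.vertex (c.curve.src k)) = (x : AddCircle L))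
    (htgt : c.map (c.curve.vertex (c.curve.tgt k)) = (y : AddCircle L)) :
    ∃ n : ℤ, c.slope k * c.curve.len k = y - x + n * L := by
  have hend := c.map_tgt k
  rw [hsrc, htgt, ← AddCircle.coe_add, eq_comm, addCircle_coe_eq_coe_iff] at hend
  obtain ⟨n, hn⟩ := hend
  exact ⟨n, by linarith⟩

theorem IsSortedLift.exists_strand (h : IsSortedLift p₀ p b X) (hl : Loopless Γ)
    {c : LabeledCover g L} (hc : c.curve.combType = Γ) {Ω : Equiv.Perm (Fin (2 * g - 2))}
    (hΩ : ∀ v, c.map (c.curve.vertex v) = (X (Ω v) : AddCircle L)) (k : Fin (3 * g - 3)) :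
    ∃ d : Strand, c.curve.len k = d.length L (X (Ω (Γ.highEnd Ω k)) - X (Ω (Γ.lowEnd Ω k))) ∧
      ((c.curve.src k = Γ.lowEnd Ω k ∧ c.curve.tgt k = Γ.highEnd Ω k ∧ c.slope k = d.slope) ∨
      (c.curve.src k = Γ.highEnd Ω k ∧ c.curve.tgt k = Γ.lowEnd Ω k ∧ c.slope k = -d.slope)) := by
  have hedge : s(c.curve.src k, c.curve.tgt k) = s(Γ.lowEnd Ω k, Γ.highEnd Ω k) := by
    rw [Γ.mk_lowEnd_highEnd Ω k, ← hc]
    rfl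
  have hpos := h.sub_pos (lowEnd_lt_highEnd hl Ω k)
  have hlt := h.sub_lt (Ω (Γ.lowEnd Ω k)) (Ω (Γ.highEnd Ω k))
  obtain ⟨n, hn⟩ := c.exists_slope_mul_len_eq (hΩ (c.curve.src k)) (hΩ (c.curve.tgt k))
  rcases Sym2.eq_iff.1 hedge with ⟨hsrc, htgt⟩ | ⟨hsrc, htgt⟩ <;> rw [hsrc, htgt] at hn
  · obtain ⟨d, hd, hlen⟩ :=
      Strand.exists_slope_eq_and_length_eq hpos hlt (c.curve.len_pos k) hn
    exact ⟨d, hlen.symm, Or.inl ⟨hsrc, htgt, hd.symm⟩⟩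
  · obtain ⟨d, hd, hlen⟩ := Strand.exists_slope_eq_and_length_eq (s := -c.slope k) (n := -n)
      hpos hlt (c.curve.len_pos k) (by push_cast; linarith)
    exact ⟨d, hlen.symm, Or.inr ⟨hsrc, htgt, by rw [hd, neg_neg]⟩⟩

variable [hL : Fact (0 < L)]

theorem IsSortedLift.exists_perm (h : IsSortedLift p₀ p b X) {c : LabeledCover g L}
    (hc : Set.range (fun v => c.map (c.curve.vertex v)) = Set.range p) :
    ∃ Ω : Equiv.Perm (Fin (2 * g - 2)),
      ∀ v, c.map (c.curve.vertex v) = (X (Ω v) : AddCircle L) := by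
  rw [← h.range] at hc
  choose ω hω using fun v => hc.subset ⟨v, rfl⟩
  have hsurj : Function.Surjective ω := fun i => by
    obtain ⟨v, hv⟩ := hc.superset ⟨i, rfl⟩
    exact ⟨v, h.coe_injective ((hω v).trans hv)⟩
  exact ⟨Equiv.ofBijective ω (Finite.surjective_iff_bijective.1 hsurj), fun v => (hω v).symm⟩

theorem exists_iso_flowCover (h : IsSortedLift p₀ p b X) (hΓ : IsFeynman Γ) (hl : Loopless Γ)
    {c : LabeledCover g L} (hc : c.curve.combType = Γ)
    (hbranch : Set.range (fun v => c.map (c.curve.vertex v)) = Set.range p) :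
    ∃ Ω f hf, LabeledCover.Iso c (flowCover h hΓ hl Ω f hf) := by
  obtain ⟨Ω, hΩ⟩ := h.exists_perm hbranch
  choose f hlen hends using h.exists_strand hl hc hΩ
  have hf : IsBalanced (Γ.lowEnd Ω) (Γ.highEnd Ω) fun k => (f k).slope := fun v => by
    rw [← c.isBalanced_slope v]
    refine Finset.sum_congr rfl fun k _ => ?_
    rcases hends k with ⟨hsrc, htgt, hslope⟩ | ⟨hsrc, htgt, hslope⟩
    · rw [hsrc, htgt, hslope]
    · rw [hsrc, htgt, hslope]
      ring
  exact ⟨Ω, f, hf, LabeledCover.iso_of_eq_or_reverse hlen (fun v => (hΩ v).symm) hends⟩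

/-! ### The count of covers -/

omit hL in
theorem classes_eq_biUnion (p₀ : AddCircle L) (p : Fin (2 * g - 2) → AddCircle L)
    (S : Set (LabeledGraph g)) (a : Fin (3 * g - 3) → ℕ) :
    LabeledCover.classes p₀ p S a = ⋃ Γ ∈ S, LabeledCover.classes p₀ p {Γ} a := by
  ext x
  simp only [Set.mem_iUnion]
  constructor
  · rintro ⟨c, hx, hS, hc⟩
    exact ⟨_, hS, c, hx, rfl, hc⟩
  · rintro ⟨Γ, hS, c, hx, rfl, hc⟩
    exact ⟨c, hx, hS, hc⟩

theorem loopless_of_hasBranchType (h : IsSortedLift p₀ p b X) {c : LabeledCover g L}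
    {a : Fin (3 * g - 3) → ℕ} (hc : c.HasBranchType p₀ p a) : Loopless c.curve.combType := by
  obtain ⟨Ω, hΩ⟩ := h.exists_perm hc.branchPoints
  refine LabeledCover.loopless_of_injective fun u v huv => ?_
  simp only [hΩ] at huv
  exact Ω.injective (h.coe_injective huv)

theorem classes_eq_empty (h : IsSortedLift p₀ p b X) (hΓ : ¬ (IsFeynman Γ ∧ Loopless Γ))
    (a : Fin (3 * g - 3) → ℕ) : LabeledCover.classes p₀ p {Γ} a = ∅ := by
  refine Set.eq_empty_of_forall_notMem ?_
  rintro _ ⟨c, rfl, rfl, hc⟩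
  exact hΓ ⟨c.curve.isFeynman, loopless_of_hasBranchType h hc⟩

/-- The correspondence between flows on the vertex orders of `Γ` and isomorphism classes of covers
of type `Γ`. -/
noncomputable def flowClass (h : IsSortedLift p₀ p b X) (hΓ : IsFeynman Γ) (hl : Loopless Γ)
    (a : Fin (3 * g - 3) → ℕ)
    (x : Σ Ω : Equiv.Perm (Fin (2 * g - 2)), flowSet (Γ.lowEnd Ω) (Γ.highEnd Ω) a) :
    LabeledCover.classes p₀ p {Γ} a :=
  ⟨⟦flowCover h hΓ hl x.1 x.2 x.2.2.1⟧, _, rfl, flowCover_combType h hΓ hl x.1 x.2 x.2.2.1,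
    flowCover_hasBranchType h hΓ hl x.1 x.2 x.2.2.1 x.2.2.2⟩

theorem bijective_flowClass (h : IsSortedLift p₀ p b X) (hΓ : IsFeynman Γ) (hl : Loopless Γ)
    (a : Fin (3 * g - 3) → ℕ) : Function.Bijective (flowClass h hΓ hl a) := by
  constructor
  · rintro ⟨Ω, f, hf⟩ ⟨Ω', f', hf'⟩ he
    obtain ⟨rfl, rfl⟩ := eq_and_eq_of_iso_flowCover h hΓ hl hf.1 hf'.1
      (Quotient.exact (congrArg Subtype.val he))
    rfl
  · rintro ⟨_, c, rfl, hc, hbranch⟩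
    obtain ⟨Ω, f, hf, hiso⟩ := exists_iso_flowCover h hΓ hl hc hbranch.branchPoints
    refine ⟨⟨Ω, f, hf, fun k => ?_⟩, Subtype.ext (Quotient.sound (Setoid.symm hiso))⟩
    rw [← hbranch.branchType k, LabeledCover.ncard_fiber_eq_of_iso hiso,
      LabeledCover.weight_eq_of_iso hiso, flowCover_branchType]

theorem finite_flowSet_of_loopless (hl : Loopless Γ) (Ω : Equiv.Perm (Fin (2 * g - 2)))
    (a : Fin (3 * g - 3) → ℕ) : (flowSet (Γ.lowEnd Ω) (Γ.highEnd Ω) a).Finite :=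
  finite_flowSet (y := fun v => ((Ω v : ℕ) : ℝ))
    (fun k => by exact_mod_cast lowEnd_lt_highEnd hl Ω k) a

theorem finite_classes (h : IsSortedLift p₀ p b X) (S : Set (LabeledGraph g))
    (a : Fin (3 * g - 3) → ℕ) : (LabeledCover.classes p₀ p S a).Finite := by
  rw [classes_eq_biUnion]
  refine S.toFinite.biUnion fun Γ _ => ?_
  by_cases hΓ : IsFeynman Γ ∧ Loopless Γ
  · have : ∀ Ω, Finite (flowSet (Γ.lowEnd Ω) (Γ.highEnd Ω) a) := fun Ω =>
      finite_flowSet_of_loopless hΓ.2 Ω a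
    exact Finite.of_surjective _ (bijective_flowClass h hΓ.1 hΓ.2 a).2
  · rw [classes_eq_empty h hΓ]
    exact Set.finite_empty

theorem tropCount_eq_zero (h : IsSortedLift p₀ p b X) (hΓ : ¬ Loopless Γ)
    (a : Fin (3 * g - 3) → ℕ) : tropCount p₀ p {Γ} a = 0 := by
  rw [tropCount, classes_eq_empty h fun hboth => hΓ hboth.2]
  exact finsum_mem_empty

theorem tropCount_singleton (h : IsSortedLift p₀ p b X) (hΓ : IsFeynman Γ) (hl : Loopless Γ)
    (a : Fin (3 * g - 3) → ℕ) :
    tropCount p₀ p {Γ} a = ∑ Ω, flowCount (Γ.lowEnd Ω) (Γ.highEnd Ω) a := by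
  have : ∀ Ω, Fintype (flowSet (Γ.lowEnd Ω) (Γ.highEnd Ω) a) := fun Ω =>
    (finite_flowSet_of_loopless hl Ω a).fintype
  rw [tropCount, ← finsum_set_coe_eq_finsum_mem,
    ← finsum_eq_of_bijective _ (bijective_flowClass h hΓ hl a)
      (f := fun x => ∏ k, ((x.2.1 k).2 : ℕ)) fun x => ?_,
    finsum_eq_sum_of_fintype, Fintype.sum_sigma]
  · refine Finset.sum_congr rfl fun Ω _ => ?_
    rw [flowCount, ← finsum_set_coe_eq_finsum_mem, finsum_eq_sum_of_fintype]
  · exact Finset.prod_congr rfl fun k _ => (flowCover_weight h hΓ hl x.1 x.2 x.2.2.1 k).symm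

theorem tropCount_finset (h : IsSortedLift p₀ p b X) (R : Finset (LabeledGraph g))
    (a : Fin (3 * g - 3) → ℕ) :
    tropCount p₀ p (R : Set (LabeledGraph g)) a = ∑ Γ ∈ R, tropCount p₀ p {Γ} a := by
  rw [tropCount, classes_eq_biUnion, finsum_mem_biUnion ?_ R.finite_toSet
    fun Γ _ => finite_classes h {Γ} a, finsum_mem_coe_finset]
  · rfl
  · intro Γ _ Γ' _ hne
    refine Set.disjoint_left.2 ?_
    rintro _ ⟨c, rfl, rfl, -⟩ ⟨c', hx, rfl, -⟩
    exact hne (LabeledCover.combType_eq_of_iso (Quotient.exact hx)).symm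

/-! ### Feynman integrals -/

theorem integrand_eq_orientedIntegrand (Γ : LabeledGraph g) (τ : Fin (3 * g - 3) → UpperHalfPlane)
    (Ω : Equiv.Perm (Fin (2 * g - 2))) (y t : Fin (2 * g - 2) → ℝ) :
    integrand Γ τ y t = orientedIntegrand τ (Γ.lowEnd Ω) (Γ.highEnd Ω) y t := by
  refine Finset.prod_congr rfl fun k _ => ?_
  rw [← Γ.mk_lowEnd_highEnd Ω k, ← propagator_neg, neg_sub]
  rfl

theorem IsStart.sub_mem_Ioo {τ : Fin (3 * g - 3) → UpperHalfPlane}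
    {Ω : Equiv.Perm (Fin (2 * g - 2))} {y : Fin (2 * g - 2) → ℝ} (hy : IsStart τ Ω y)
    (hl : Loopless Γ) (k : Fin (3 * g - 3)) :
    y (Γ.highEnd Ω k) - y (Γ.lowEnd Ω k) ∈ Set.Ioo 0 (τ k).im :=
  ⟨sub_pos.2 (hy.order _ _ (lowEnd_lt_highEnd hl Ω k)), (le_abs_self _).trans_lt (hy.small _ _ k)⟩

theorem integrableOn_integrand (hl : Loopless Γ) {τ : Fin (3 * g - 3) → UpperHalfPlane}
    {Ω : Equiv.Perm (Fin (2 * g - 2))} {y : Fin (2 * g - 2) → ℝ} (hy : IsStart τ Ω y) :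
    MeasureTheory.IntegrableOn (integrand Γ τ y) (Set.Icc 0 1) := by
  rw [funext (integrand_eq_orientedIntegrand Γ τ Ω y)]
  exact (continuous_orientedIntegrand (hy.sub_mem_Ioo hl)).continuousOn.integrableOn_compact
    isCompact_Icc

variable {τ : Fin (3 * g - 3) → UpperHalfPlane}
  {y : Equiv.Perm (Fin (2 * g - 2)) → Fin (2 * g - 2) → ℝ}

theorem hasSum_tropCount_singleton (h : IsSortedLift p₀ p b X) (hΓ : IsFeynman Γ)
    (hl : Loopless Γ) (hy : ∀ Ω, IsStart τ Ω (y Ω)) :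
    HasSum (fun a => (tropCount p₀ p {Γ} a : ℂ) * qMonomial τ a) (feynmanIntegral Γ τ y) := by
  have hintegral : feynmanIntegral Γ τ y = ∑ Ω, ∫ t in Set.Icc (0 : Fin (2 * g - 2) → ℝ) 1,
      orientedIntegrand τ (Γ.lowEnd Ω) (Γ.highEnd Ω) (y Ω) t :=
    Finset.sum_congr rfl fun Ω _ => by
      rw [feynmanIntegralAt, funext (integrand_eq_orientedIntegrand Γ τ Ω (y Ω))]
  rw [hintegral]
  refine (hasSum_sum fun Ω _ => hasSum_flowCount ((hy Ω).sub_mem_Ioo hl)).congr_fun fun a => ?_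
  rw [tropCount_singleton h hΓ hl, Nat.cast_sum, Finset.sum_mul]

open Classical in
theorem hasSum_tropCount_finset (h : IsSortedLift p₀ p b X) {R : Finset (LabeledGraph g)}
    (hR : ∀ Γ ∈ R, IsFeynman Γ) (hy : ∀ Ω, IsStart τ Ω (y Ω)) :
    HasSum (fun a => (tropCount p₀ p (R : Set (LabeledGraph g)) a : ℂ) * qMonomial τ a)
      (∑ Γ ∈ R with Loopless Γ, feynmanIntegral Γ τ y) := by
  rw [Finset.sum_filter]
  refine (hasSum_sum (f := fun Γ a => (tropCount p₀ p {Γ} a : ℂ) * qMonomial τ a)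
    fun Γ hΓ => ?_).congr_fun fun a => ?_
  · split_ifs with hl
    · exact hasSum_tropCount_singleton h (hR Γ hΓ) hl hy
    · simp only [tropCount_eq_zero h hl, Nat.cast_zero, zero_mul, hasSum_zero]
  · rw [tropCount_finset h, Nat.cast_sum, Finset.sum_mul]

end CountOfCovers

end TropicalMirror

open TropicalMirror LabeledGraph in
open Classical in
theorem mainTheorem1 (g : ℕ) (hg : 1 < g) (L : ℝ) [Fact (0 < L)]
    (p₀ : AddCircle L) (p : Fin (2 * g - 2) → AddCircle L)
    (hp : Function.Injective p) (hp₀ : p₀ ∉ Set.range p) :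
    -- the counts are finite
    (∀ a, (LabeledCover.classes p₀ p (Set.univ : Set (LabeledGraph g)) a).Finite) ∧
    -- a Feynman graph with a loop is not the type of a cover that is counted
    (∀ Γ : LabeledGraph g, IsFeynman Γ → ¬ Loopless Γ → ∀ a, tropCount p₀ p {Γ} a = 0) ∧
    ∀ (τ : Fin (3 * g - 3) → UpperHalfPlane)
      (y : Equiv.Perm (Fin (2 * g - 2)) → Fin (2 * g - 2) → ℝ), (∀ Ω, IsStart τ Ω (y Ω)) →
      -- the integral of each graph: its `q^{2a}`-coefficient is `N_{a,Γ}`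
      (∀ Γ : LabeledGraph g, IsFeynman Γ → Loopless Γ →
        (∀ Ω, MeasureTheory.IntegrableOn (integrand Γ τ (y Ω)) (Set.Icc 0 1)) ∧
        HasSum (fun a => (tropCount p₀ p {Γ} a : ℂ) * qMonomial τ a) (feynmanIntegral Γ τ y)) ∧
      -- the generating function `F_g`, both for one reference labeling of each graph and for
      -- all labelings
      (∀ R : Finset (LabeledGraph g), (IsReferenceSystem R ∨ ∀ Γ, Γ ∈ R ↔ IsFeynman Γ) →
        HasSum (fun a => (tropCount p₀ p (R : Set (LabeledGraph g)) a : ℂ) * qMonomial τ a)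
          (∑ Γ ∈ R with Loopless Γ, feynmanIntegral Γ τ y)) := by
  obtain ⟨b, X, h⟩ := IsSortedLift.exists_of_injective hp hp₀
  refine ⟨finite_classes h Set.univ, fun Γ _ hΓ => tropCount_eq_zero h hΓ, fun τ y hy =>
    ⟨fun Γ hΓ hl => ⟨fun Ω => integrableOn_integrand hl (hy Ω),
      hasSum_tropCount_singleton h hΓ hl hy⟩, fun R hR => ?_⟩⟩
  have hFeynman : ∀ Γ ∈ R, IsFeynman Γ := hR.elim (·.isFeynman) fun hall Γ => (hall Γ).1
  exact hasSum_tropCount_finset h hFeynman hy
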